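/- Let $\Omega\subset\mathbb R^2$ be a bounded domain whose boundary is a simple closed polygon with vertices $x_1,\dots,x_m$ ($m\ge 3$, counterclockwise, indices cyclic) and interior angles $\omega_j\in(0,2\pi)$. Let $r_j=|x-x_j|$, let $\theta_j$ be the angle at $x_j$ measured counterclockwise from the side $[x_j,x_{j+1}]$, and let $K_j=\{0<r_j,\ 0<\theta_j<\omega_j\}$. Let $a_{ik}=a_{ki}\in C^{0,1}(\bar\Omega)$ ($1\le i,k\le 2$) be uniformly elliptic: there is $\Lambda>0$ with $\sum_{i,k}a_{ik}(x)\xi_i\xi_k\ge\Lambda|\xi|^2$ for all $\xi\in\mathbb R^2$ and almost all $x\in\Omega$. Let $\lambda_j$ be the smallest $\lambda>0$ for which there is a nonzero function $y=r_j^{\lambda}\phi(\theta_j)$, with $\phi$ smooth enough ($y$ is $C^2$ up to the sides of $K_j$, away from the vertex), such that $\sum_{i,k}\partial_{x_k}(a_{ik}(x_j)\partial_{x_i}y)=0$ in $K_j$ and $\sum_{i,k}a_{ik}(x_j)\,\partial_{x_i}y\,n_k=0$ on both sides of $K_j$, where $n$ is the outer normal. For each $j$ let $0<R_j\le 1$ be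 such that $R_j<|x_i-x_j|$ for all $i\ne j$; put $\Omega_{R_j}=\Omega\cap B(x_j,R_j)$ and $\Omega^0=\Omega\setminus\bigcup_{j}\Omega_{R_j/2}$. For $1\le p<\infty$ and $\vec\beta\in\mathbb R^m$, let $W^{1,p}_{\vec\beta}(\Omega)$ be the space of the functions $v$, weakly differentiable in $\Omega$, with $$\|v\|_{W^{1,p}(\Omega^0)}+\sum_{j=1}^m\Big(\sum_{|\alpha|\le1}\|r_j^{\beta_j}D^\alpha v\|_{L^p(\Omega_{R_j})}^p\Big)^{1/p}<\infty .$$ **Lemma 3.6.** Let $1<q<\infty$ and $\max\{2,q\}<\delta\le\infty$. Let $\varphi\in W^{1,\delta}(\Omega)$ and let $\psi\in W^{1,q}_{\vec\beta}(\Omega)$, where $\beta_j\ge 0$ and $2-\frac2q-\lambda_j<\beta_j<2-\frac2q$ for all $j\in\{1,\dots,m\}$. Then $\psi\varphi\in W^{1,q}_{\vec\beta}(\Omega)$. -/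

import Mathlib

open MeasureTheory Set
open scoped ENNReal ContDiff

noncomputable section

/-- The Euclidean plane. -/
abbrev Plane : Type := EuclideanSpace ℝ (Fin 2)

/-- Counterclockwise rotation of the vector `d` by the angle `θ`. -/
def rot (θ : ℝ) (d : Plane) : Plane :=
  !₂[Real.cos θ * d 0 - Real.sin θ * d 1, Real.sin θ * d 0 + Real.cos θ * d 1]

/-- The unit vector in the direction of `d` (for `d ≠ 0`). -/
def unitDir (d : Plane) : Plane := ‖d‖⁻¹ • d

/-- The `i`-th coordinate vector. -/
def coordVec (i : Fin 2) : Plane := EuclideanSpace.single i (1 : ℝ)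

/-- The partial derivative `∂f/∂xᵢ`. -/
def partialDeriv (i : Fin 2) (f : Plane → ℝ) (x : Plane) : ℝ := fderiv ℝ f x (coordVec i)

/-- The infinite open cone with vertex `p`: in polar coordinates `(r, θ)` centred at `p`, with
`θ` measured counterclockwise from the direction `d`, it is `{0 < r, 0 < θ < om}`. -/
def openCone (p d : Plane) (om : ℝ) : Set Plane :=
  {z | ∃ r θ : ℝ, 0 < r ∧ 0 < θ ∧ θ < om ∧ z = p + r • rot θ (unitDir d)}

/-- The same cone together with its two sides, but without its vertex. -/
def coneWithSides (p d : Plane) (om : ℝ) : Set Plane :=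
  {z | ∃ r θ : ℝ, 0 < r ∧ 0 ≤ θ ∧ θ ≤ om ∧ z = p + r • rot θ (unitDir d)}

/-! ### Polygonal domains -/

/-- The side of the polygon that connects the `j`-th vertex and the next one (cyclically). -/
def side {m : ℕ} [NeZero m] (x : Fin m → Plane) (j : Fin m) : Set Plane :=
  segment ℝ (x j) (x (j + 1))

/-- `Ω` is a bounded plane domain whose boundary is the simple closed polygon with the `m`
vertices `x j`, listed counterclockwise (cyclically), and `om j ∈ (0, 2π)` is the angle interior to
`Ω` at `x j`: it is the angle from the side leaving `x j` to the side arriving at `x j`, measured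
counterclockwise, and the cone of opening `om j` swept in between is the one which coincides with
`Ω` near `x j` (this is what it means for the vertices to be ordered counterclockwise). -/
structure IsPolygonalDomain {m : ℕ} [NeZero m] (Ω : Set Plane) (x : Fin m → Plane)
    (om : Fin m → ℝ) : Prop where
  isOpen : IsOpen Ω
  isConnected : IsConnected Ω
  isBounded : Bornology.IsBounded Ω
  three_le : 3 ≤ m
  vertex_injective : Function.Injective x
  side_inter_next : ∀ j, side x j ∩ side x (j + 1) = {x (j + 1)}
  side_disjoint : ∀ i j, i ≠ j → i ≠ j + 1 → j ≠ i + 1 → Disjoint (side x i) (side x j)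
  frontier_eq : frontier Ω = ⋃ j, side x j
  angle_pos : ∀ j, 0 < om j
  angle_lt : ∀ j, om j < 2 * Real.pi
  angle_eq : ∀ j, unitDir (x (j - 1) - x j) = rot (om j) (unitDir (x (j + 1) - x j))
  angle_interior : ∀ j, ∃ ρ : ℝ, 0 < ρ ∧
    Ω ∩ Metric.ball (x j) ρ = openCone (x j) (x (j + 1) - x j) (om j) ∩ Metric.ball (x j) ρ

/-! ### The differential operator and its leading singular exponents -/

/-- The coefficient matrix `a` of `A y = - ∑ᵢₖ ∂ₖ (aᵢₖ ∂ᵢ y)` is symmetric, uniformly elliptic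
in `Ω` and Lipschitz continuous on the closure of `Ω`. -/
structure IsEllipticCoeff (Ω : Set Plane) (a : Plane → Matrix (Fin 2) (Fin 2) ℝ) : Prop where
  lipschitz : ∀ i k, ∃ C : NNReal, LipschitzOnWith C (fun z => a z i k) (closure Ω)
  symm : ∀ z ∈ closure Ω, ∀ i k, a z i k = a z k i
  elliptic : ∃ Λ : ℝ, 0 < Λ ∧ ∀ᵐ z ∂(volume.restrict Ω), ∀ ξ : Plane,
    Λ * ‖ξ‖ ^ 2 ≤ ∑ i, ∑ k, a z i k * ξ i * ξ k

/-- `μ > 0` is a singular exponent of the constant coefficient operator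
`y ↦ ∑ᵢₖ ∂ₖ (Mᵢₖ ∂ᵢ y)` in the cone `K` with vertex `p`, first side in direction `d` and opening
`om`: there is a nonzero solution `y = r ^ μ φ(θ)`, which is twice continuously differentiable up to
the two sides of the cone, of the equation in `K` with vanishing conormal derivative
`∑ᵢₖ Mᵢₖ ∂ᵢ y nₖ` on both sides. The outer normal `n` is the first side turned by `-π/2` on the
first side and the second side turned by `π/2` on the second one. -/
def IsSingularExponent (M : Matrix (Fin 2) (Fin 2) ℝ) (p d : Plane) (om μ : ℝ) : Prop :=
  0 < μ ∧ ∃ (φ : ℝ → ℝ) (y : Plane → ℝ),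
    (∃ θ, 0 < θ ∧ θ < om ∧ φ θ ≠ 0) ∧
    (∀ r θ : ℝ, 0 < r → 0 ≤ θ → θ ≤ om → y (p + r • rot θ (unitDir d)) = r ^ μ * φ θ) ∧
    ContDiffOn ℝ 2 y (coneWithSides p d om) ∧
    (∀ z ∈ openCone p d om,
      ∑ i, ∑ k, partialDeriv k (fun w => M i k * partialDeriv i y w) z = 0) ∧
    (∀ r : ℝ, 0 < r →
      ∑ i, ∑ k, M i k *
        fderivWithin ℝ y (coneWithSides p d om) (p + r • unitDir d) (coordVec i) *
          rot (-(Real.pi / 2)) (unitDir d) k = 0) ∧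
    (∀ r : ℝ, 0 < r →
      ∑ i, ∑ k, M i k *
        fderivWithin ℝ y (coneWithSides p d om) (p + r • rot om (unitDir d)) (coordVec i) *
          rot (om + Real.pi / 2) (unitDir d) k = 0)

/-- `μ` is the leading (i.e. the smallest) singular exponent. -/
def IsLeadingExponent (M : Matrix (Fin 2) (Fin 2) ℝ) (p d : Plane) (om μ : ℝ) : Prop :=
  IsLeast {ν : ℝ | IsSingularExponent M p d om ν} μ

/-! ### Sobolev spaces -/

/-- `g` is the weak partial derivative `∂f/∂xᵢ` in the open set `U`. -/
def HasWeakPartialDeriv (U : Set Plane) (i : Fin 2) (f g : Plane → ℝ) : Prop :=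
  LocallyIntegrableOn f U ∧ LocallyIntegrableOn g U ∧
    ∀ η : Plane → ℝ, ContDiff ℝ ∞ η → HasCompactSupport η → tsupport η ⊆ U →
      ∫ z in U, f z * partialDeriv i η z = - ∫ z in U, g z * η z

/-- `v` belongs to the Sobolev space `W^{1,p}(U)`, `U` open. -/
def MemSobolev (U : Set Plane) (p : ℝ≥0∞) (v : Plane → ℝ) : Prop :=
  ∃ g : Fin 2 → Plane → ℝ, (∀ i, HasWeakPartialDeriv U i v (g i)) ∧
    MemLp v p (volume.restrict U) ∧ ∀ i, MemLp (g i) p (volume.restrict U)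

/-- The neighbourhood `Ω_{R_j}` of the corner `x j`. -/
def cornerNhd {m : ℕ} (Ω : Set Plane) (x : Fin m → Plane) (R : Fin m → ℝ) (j : Fin m) :
    Set Plane :=
  Ω ∩ Metric.ball (x j) (R j)

/-- The part `Ω⁰ = Ω \ ⋃ Ω_{R_j / 2}` of the domain away from the corners. -/
def awayFromCorners {m : ℕ} (Ω : Set Plane) (x : Fin m → Plane) (R : Fin m → ℝ) : Set Plane :=
  Ω \ ⋃ j, cornerNhd Ω x (fun i => R i / 2) j

/-- The radii `R j ∈ (0, 1]` of the corner neighbourhoods are admissible: no neighbourhood reaches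
another corner. -/
def AdmissibleRadii {m : ℕ} (x : Fin m → Plane) (R : Fin m → ℝ) : Prop :=
  ∀ j, 0 < R j ∧ R j ≤ 1 ∧ ∀ i, i ≠ j → R j < dist (x i) (x j)

/-- `v` belongs to the weighted Sobolev space `W^{1,p}_β(Ω)`: `v` and its weak first derivatives
are in `L^p(Ω⁰)`, and multiplied by `r_j ^ β_j`, `r_j = |z - x_j|`, they are in `L^p(Ω_{R_j})`
for every corner `x j`. -/
def MemWeightedSobolev {m : ℕ} (Ω : Set Plane) (x : Fin m → Plane) (R β : Fin m → ℝ)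
    (p : ℝ≥0∞) (v : Plane → ℝ) : Prop :=
  ∃ g : Fin 2 → Plane → ℝ, (∀ i, HasWeakPartialDeriv Ω i v (g i)) ∧
    MemLp v p (volume.restrict (awayFromCorners Ω x R)) ∧
    (∀ i, MemLp (g i) p (volume.restrict (awayFromCorners Ω x R))) ∧
    ∀ j, MemLp (fun z => dist z (x j) ^ β j * v z) p (volume.restrict (cornerNhd Ω x R j)) ∧
      ∀ i, MemLp (fun z => dist z (x j) ^ β j * g i z) p
        (volume.restrict (cornerNhd Ω x R j))

end

/-!
The product `ψ φ` has the weak gradient `φ ∇ψ + ψ ∇φ`, so that two embeddings are needed: functions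
`φ` in `W^{1,δ}(Ω)` are bounded since `δ > 2`, and `W ψ ∇φ` is in `L^q(Ω)`, where `W = ∏ⱼ rⱼ ^ βⱼ`
(`cornerWeight`) is a global weight equivalent to the local ones (`memWeightedSobolev_iff`). The
second embedding amounts to `W ψ ∈ L^s(Ω)` with `1/s = 1/q - 1/δ > 1/q - 1/2`, and it is proved in
the dual form of a bound for the products `W ψ H` with functions `H` in `L^δ(Ω)`.

Both embeddings follow from one pointwise estimate in convex open sets `S`. On almost every segment
the increment of a weakly differentiable function is at most the integral of the gradient
(`ae_ae_enorm_sub_le`). Averaging over the segments that end in a fixed compact set `A ⊆ S` gives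
`W(x) |u(x)| ≤ C₀ + C₁ ∫_S W |∇u| |x - z|⁻¹ dz` (`exists_weight_mul_enorm_le`), as soon as
`W(x) ≤ C W(z)` for `z` on the segments from `x` to `A`. Because a convex open set which omits a
corner lies on one side of a line through it, such segments do not approach the corner, and since
`β ≥ 0` the weight satisfies this condition (`exists_cornerWeight_segment`); no Hardy inequality is
needed. The Riesz potential on the right is then estimated by Hölder's inequality
(`exists_riesz_le`, `exists_lintegral_mul_riesz_rpow_le`).

The lines that carry the sides of the polygon cut `Ω` near each point into finitely many convex
sectors, hence `Ω` is, up to a null set, a finite union of small convex open sets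
(`IsPolygonalDomain.exists_finite_convex_cover`). As only norms have to be bounded, no gluing of
functions is involved. Finally the product rule (`HasWeakPartialDeriv.mul`) holds because the defect
of the rule for `ψ` and a translate of `φ` depends continuously on the translation and has vanishing
averages against test functions.
-/

/-! ### Increments along segments -/

theorem integrable_comp_add_smul {g : Plane → ℝ} (hg : Integrable g) (hgm : Measurable g)
    (h : Plane) : Integrable (fun p : Plane × ℝ => g (p.1 + p.2 • h))
      ((volume : Measure Plane).prod (volume.restrict (Ioc (0 : ℝ) 1))) := by
  rw [integrable_prod_iff' (by
    apply Measurable.aestronglyMeasurable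
    exact hgm.comp (by fun_prop))]
  refine ⟨.of_forall fun t => hg.comp_add_right (t • h), ?_⟩
  have : ∀ t : ℝ, ∫ x : Plane, ‖g (x + t • h)‖ = ∫ x, ‖g x‖ := fun t =>
    integral_add_right_eq_self (fun x => ‖g x‖) (t • h)
  simp only [this]
  exact integrable_const _

/-- The increment of a function along a fixed vector is tested against `η`: only the weak
derivative tested against the translates of `η` along the vector enters. -/
theorem integral_mul_increment_eq_zero {u g η : Plane → ℝ} (hu : Integrable u)
    (hg : Integrable g) (hgm : Measurable g) (hη : ContDiff ℝ ∞ η)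
    (hηc : HasCompactSupport η) (h : Plane)
    (hw : ∀ t ∈ Ioc (0 : ℝ) 1,
      ∫ x, u x * fderiv ℝ η (x - t • h) h = - ∫ x, g x * η (x - t • h)) :
    ∫ x, η x * (u (x + h) - u x - ∫ t in Ioc (0 : ℝ) 1, g (x + t • h)) = 0 := by
  obtain ⟨M, hM⟩ := hηc.exists_bound_of_continuous hη.continuous
  have hfd : Continuous (fun x => fderiv ℝ η x h) :=
    (hη.continuous_fderiv (by simp)).clm_apply continuous_const
  obtain ⟨M', hM'⟩ := (hηc.fderiv_apply ℝ h).exists_bound_of_continuous hfd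
  have iu : ∀ a : Plane, Integrable (fun x => u x * η (x - a)) := fun a =>
    hu.mul_bdd (c := M) (hη.continuous.comp (continuous_id.sub continuous_const)).aestronglyMeasurable
      (.of_forall fun x => hM _)
  have iF := integrable_comp_add_smul hg hgm h
  have iF' : Integrable (fun p : Plane × ℝ => η p.1 * g (p.1 + p.2 • h))
      ((volume : Measure Plane).prod (volume.restrict (Ioc (0 : ℝ) 1))) :=
    iF.bdd_mul (c := M) (hη.continuous.comp continuous_fst).aestronglyMeasurable
      (.of_forall fun x => hM _)
  -- the fundamental theorem of calculus for the test function
  have ftc : ∀ x : Plane, η (x - h) - η x = - ∫ t in Ioc (0 : ℝ) 1, fderiv ℝ η (x - t • h) h := by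
    intro x
    have hd : ∀ t : ℝ, HasDerivAt (fun t : ℝ => η (x - t • h)) (-(fderiv ℝ η (x - t • h) h)) t := by
      intro t
      have h1 : HasDerivAt (fun t : ℝ => x - t • h) (-h) t := by
        simpa using ((hasDerivAt_id t).smul_const h).const_sub x
      have h2 := ((hη.differentiable (by simp)) (x - t • h)).hasFDerivAt.comp_hasDerivAt t h1
      simpa [Function.comp_def] using h2
    have := intervalIntegral.integral_eq_sub_of_hasDerivAt (a := 0) (b := 1)
      (fun t _ => hd t) (by
        apply Continuous.intervalIntegrable
        exact (hfd.comp (by fun_prop : Continuous fun t : ℝ => x - t • h)).neg)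
    rw [intervalIntegral.integral_of_le zero_le_one, integral_neg] at this
    simpa using this.symm
  have iU : Integrable (fun p : Plane × ℝ => u p.1 * fderiv ℝ η (p.1 - p.2 • h) h)
      ((volume : Measure Plane).prod (volume.restrict (Ioc (0 : ℝ) 1))) := by
    refine (hu.comp_fst _).mul_bdd (c := M') ?_ (.of_forall fun x => hM' _)
    exact (hfd.comp (by fun_prop : Continuous fun p : Plane × ℝ => p.1 - p.2 • h)).aestronglyMeasurable
  have key : ∫ x, u x * (η (x - h) - η x) = ∫ x, η x * ∫ t in Ioc (0 : ℝ) 1, g (x + t • h) := by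
    calc ∫ x, u x * (η (x - h) - η x)
        = - ∫ x, ∫ t in Ioc (0 : ℝ) 1, u x * fderiv ℝ η (x - t • h) h := by
          rw [← integral_neg]
          congr 1; ext x
          rw [ftc x, integral_const_mul]; ring
      _ = - ∫ t in Ioc (0 : ℝ) 1, ∫ x, u x * fderiv ℝ η (x - t • h) h := by
          rw [integral_integral_swap iU]
      _ = ∫ t in Ioc (0 : ℝ) 1, ∫ x, η x * g (x + t • h) := by
          rw [← integral_neg]
          refine setIntegral_congr_fun measurableSet_Ioc fun t ht => ?_
          simp only [hw t ht, neg_neg]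
          rw [← integral_add_right_eq_self (fun x => g x * η (x - t • h)) (t • h)]
          simp [mul_comm]
      _ = ∫ x, η x * ∫ t in Ioc (0 : ℝ) 1, g (x + t • h) := by
          rw [← integral_integral_swap iF']
          simp_rw [integral_const_mul]
  have e1 : ∫ x, η x * u (x + h) = ∫ x, u x * η (x - h) := by
    rw [← integral_add_right_eq_self (fun x => u x * η (x - h)) h]
    simp [mul_comm]
  have i1 : Integrable (fun x => η x * u (x + h)) :=
    (hu.comp_add_right h).bdd_mul (c := M) hη.continuous.aestronglyMeasurable (.of_forall fun x => hM _)
  have i2 : Integrable (fun x => η x * u x) :=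
    hu.bdd_mul (c := M) hη.continuous.aestronglyMeasurable (.of_forall fun x => hM _)
  have i3 : Integrable (fun x => η x * ∫ t in Ioc (0 : ℝ) 1, g (x + t • h)) :=
    iF.integral_prod_left.bdd_mul (c := M) hη.continuous.aestronglyMeasurable (.of_forall fun x => hM _)
  calc ∫ x, η x * (u (x + h) - u x - ∫ t in Ioc (0 : ℝ) 1, g (x + t • h))
      = ∫ x, (η x * u (x + h) - η x * u x - η x * ∫ t in Ioc (0 : ℝ) 1, g (x + t • h)) := by
        congr 1; ext x; ring
    _ = 0 := by
        rw [integral_sub (by exact i1.sub i2) i3, integral_sub i1 i2, e1, ← key]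
        simp_rw [mul_sub]
        rw [integral_sub (iu h) (by simpa using iu 0)]
        simp [mul_comm]

theorem eq_sum_coordVec (h : Plane) : h = ∑ i, h i • coordVec i := by
  ext k
  fin_cases k <;> simp [coordVec, Fin.sum_univ_two]

theorem fderiv_apply_eq_sum (η : Plane → ℝ) (x h : Plane) :
    fderiv ℝ η x h = ∑ i, h i * partialDeriv i η x := by
  conv_lhs => rw [eq_sum_coordVec h]
  simp [partialDeriv]

theorem setIntegral_mul_eq_integral_indicator {S K : Set Plane} (hKS : K ⊆ S)
    (hS : MeasurableSet S) (u v : Plane → ℝ)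
    (hv : ∀ x, x ∉ K → v x = 0) : ∫ x, K.indicator u x * v x = ∫ x in S, u x * v x := by
  rw [← integral_indicator hS]
  congr 1; ext x
  by_cases hx : x ∈ K
  · simp [hx, hKS hx]
  · by_cases hx' : x ∈ S <;> simp [hx, hx', hv x hx]

/-- Along a segment contained in a convex open set, the increment of a weakly differentiable
function is the integral of its weak derivative, for almost every starting point. -/
theorem ae_increment_eq_integral {S : Set Plane} (hSo : IsOpen S) (hSc : Convex ℝ S)
    {u : Plane → ℝ} {g : Fin 2 → Plane → ℝ} (hgm : ∀ i, Measurable (g i))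
    (hw : ∀ i, HasWeakPartialDeriv S i u (g i)) (h : Plane) :
    ∀ᵐ x, x ∈ S → x + h ∈ S →
      u (x + h) - u x = ∫ t in Ioc (0 : ℝ) 1, ∑ i, h i * g i (x + t • h) := by
  set U : Set Plane := {x | x ∈ S ∧ x + h ∈ S}
  have hUo : IsOpen U := hSo.inter (hSo.preimage (continuous_id.add continuous_const))
  set G : Plane → ℝ := fun x => ∑ i, h i * g i x with hG
  have hGm : Measurable G := by fun_prop
  have hum : LocallyIntegrableOn u S := (hw 0).1
  have hGl : LocallyIntegrableOn G S := by
    rw [locallyIntegrableOn_iff hSo.isLocallyClosed]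
    intro k hk hkc
    exact integrable_finsetSum _ fun i _ =>
      (((locallyIntegrableOn_iff hSo.isLocallyClosed).1 (hw i).2.1 k hk hkc).const_mul (h i))
  -- the set swept by the translates of a compact set
  have swept : ∀ K : Set Plane, K ⊆ U → IsCompact K →
      ∃ K' : Set Plane, IsCompact K' ∧ K' ⊆ S ∧ ∀ x ∈ K, ∀ t ∈ Icc (0 : ℝ) 1, x + t • h ∈ K' := by
    intro K hK hKc
    refine ⟨(fun p : Plane × ℝ => p.1 + p.2 • h) '' (K ×ˢ Icc (0 : ℝ) 1),
      (hKc.prod isCompact_Icc).image (by fun_prop), ?_, fun x hx t ht => ⟨(x, t), ⟨hx, ht⟩, rfl⟩⟩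
    rintro _ ⟨⟨x, t⟩, ⟨hx, ht⟩, rfl⟩
    exact hSc.add_smul_mem (hK hx).1 (hK hx).2 ht
  have locInt : ∀ {f : Plane → ℝ}, LocallyIntegrableOn f S → ∀ K' : Set Plane, K' ⊆ S →
      IsCompact K' → Integrable (K'.indicator f) := by
    intro f hf K' hK' hKc'
    rw [integrable_indicator_iff hKc'.measurableSet]
    exact (locallyIntegrableOn_iff hSo.isLocallyClosed).1 hf K' hK' hKc'
  have agree : ∀ K K' : Set Plane, (∀ x ∈ K, ∀ t ∈ Icc (0 : ℝ) 1, x + t • h ∈ K') → ∀ x ∈ K,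
      K'.indicator u (x + h) - K'.indicator u x - ∫ t in Ioc (0 : ℝ) 1, K'.indicator G (x + t • h)
        = u (x + h) - u x - ∫ t in Ioc (0 : ℝ) 1, G (x + t • h) := by
    intro K K' hKK x hx
    have h0 : x ∈ K' := by simpa using hKK x hx 0 (by simp)
    have h1 : x + h ∈ K' := by simpa using hKK x hx 1 (by simp)
    rw [indicator_of_mem h0, indicator_of_mem h1]
    congr 1
    refine setIntegral_congr_fun measurableSet_Ioc fun t ht => ?_
    simp only [indicator_of_mem (hKK x hx t (Ioc_subset_Icc_self ht))]
  have main : ∀ᵐ x, x ∈ U → u (x + h) - u x - ∫ t in Ioc (0 : ℝ) 1, G (x + t • h) = 0 := by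
    refine IsOpen.ae_eq_zero_of_integral_contDiff_smul_eq_zero hUo ?_ ?_
    · rw [locallyIntegrableOn_iff hUo.isLocallyClosed]
      intro K hK hKc
      obtain ⟨K', hKc', hK', hKK⟩ := swept K hK hKc
      have i1 := locInt hum K' hK' hKc'
      have i2 := locInt hGl K' hK' hKc'
      have i3 : Integrable (fun x => K'.indicator u (x + h) - K'.indicator u x -
          ∫ t in Ioc (0 : ℝ) 1, K'.indicator G (x + t • h)) :=
        ((i1.comp_add_right h).sub i1).sub
          (integrable_comp_add_smul i2 (hGm.indicator hKc'.measurableSet) h).integral_prod_left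
      exact i3.integrableOn.congr_fun (agree K K' hKK) hKc.measurableSet
    · intro η hη hηc hηU
      obtain ⟨K', hKc', hK', hKK⟩ := swept _ hηU hηc
      have i1 := locInt hum K' hK' hKc'
      have i2 := locInt hGl K' hK' hKc'
      have := integral_mul_increment_eq_zero i1 i2 (hGm.indicator hKc'.measurableSet) hη hηc h ?_
      · refine Eq.trans ?_ this
        congr 1; ext x
        by_cases hx : x ∈ tsupport η
        · rw [agree _ K' hKK x hx, smul_eq_mul]
        · simp [image_eq_zero_of_notMem_tsupport hx]
      intro t ht
      have ht' := Ioc_subset_Icc_self ht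
      set ηt : Plane → ℝ := fun x => η (x - t • h) with hηt
      have hηts : tsupport ηt ⊆ K' := by
        intro x hx
        have : x - t • h ∈ tsupport η :=
          tsupport_comp_subset_preimage η (f := fun x : Plane => x - t • h) (by fun_prop) hx
        simpa using hKK _ this t ht'
      have hηtd : ContDiff ℝ ∞ ηt := hη.comp (contDiff_id.sub contDiff_const)
      have hηtc : HasCompactSupport ηt := HasCompactSupport.of_support_subset_isCompact hKc'
        ((subset_tsupport ηt).trans hηts)
      have hfd : ∀ x, fderiv ℝ η (x - t • h) h = ∑ i, h i * partialDeriv i ηt x := by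
        intro x
        rw [← fderiv_apply_eq_sum, hηt, fderiv_comp_sub]
      have hp0 : ∀ i x, x ∉ K' → partialDeriv i ηt x = 0 := by
        intro i x hx
        have : x ∉ tsupport (fderiv ℝ ηt) := fun hx' => hx (hηts (tsupport_fderiv_subset ℝ hx'))
        simp [partialDeriv, image_eq_zero_of_notMem_tsupport this]
      have hz : ∀ x, x ∉ K' → ηt x = 0 := fun x hx =>
        image_eq_zero_of_notMem_tsupport fun hx' => hx (hηts hx')
      have hpc : ∀ i, Continuous (partialDeriv i ηt) := fun i =>
        (hηtd.continuous_fderiv (by simp)).clm_apply continuous_const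
      have hpb : ∀ i, ∃ C, ∀ x, ‖partialDeriv i ηt x‖ ≤ C := fun i =>
        (hηtc.fderiv_apply ℝ (coordVec i)).exists_bound_of_continuous (hpc i)
      obtain ⟨C0, hC0⟩ := hηtc.exists_bound_of_continuous hηtd.continuous
      calc ∫ x, K'.indicator u x * fderiv ℝ η (x - t • h) h
          = ∫ x, ∑ i, h i * (K'.indicator u x * partialDeriv i ηt x) := by
            congr 1; ext x
            rw [hfd, Finset.mul_sum]
            exact Finset.sum_congr rfl fun i _ => by ring
        _ = ∑ i, h i * ∫ x, K'.indicator u x * partialDeriv i ηt x := by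
            rw [integral_finsetSum]
            · simp_rw [integral_const_mul]
            · intro i _
              obtain ⟨C, hC⟩ := hpb i
              exact (i1.mul_bdd (c := C) (hpc i).aestronglyMeasurable (.of_forall hC)).const_mul _
        _ = ∑ i, h i * (- ∫ x, K'.indicator (g i) x * ηt x) := by
            refine Finset.sum_congr rfl fun i _ => ?_
            rw [setIntegral_mul_eq_integral_indicator hK' hSo.measurableSet _ _ (hp0 i),
              setIntegral_mul_eq_integral_indicator hK' hSo.measurableSet _ _ hz,
              (hw i).2.2 ηt hηtd hηtc (hηts.trans hK')]
        _ = - ∫ x, ∑ i, h i * (K'.indicator (g i) x * ηt x) := by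
            rw [integral_finsetSum]
            · simp_rw [integral_const_mul, mul_neg, Finset.sum_neg_distrib]
            · intro i _
              exact ((locInt (hw i).2.1 K' hK' hKc').mul_bdd (c := C0)
                hηtd.continuous.aestronglyMeasurable (.of_forall hC0)).const_mul _
        _ = - ∫ x, K'.indicator G x * η (x - t • h) := by
            congr 2; ext x
            by_cases hx : x ∈ K'
            · simp only [indicator_of_mem hx, hG, Finset.sum_mul, hηt]
              exact Finset.sum_congr rfl fun i _ => by ring
            · simp [hx]
  filter_upwards [main] with x hx h1 h2
  exact sub_eq_zero.1 (hx ⟨h1, h2⟩)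

/-- The size `∑ᵢ |gᵢ|` of a family of partial derivatives. -/
noncomputable def gradNorm (g : Fin 2 → Plane → ℝ) (z : Plane) : ℝ≥0∞ := ∑ i, ‖g i z‖ₑ

theorem measurable_gradNorm {g : Fin 2 → Plane → ℝ} (hg : ∀ i, Measurable (g i)) :
    Measurable (gradNorm g) := by
  unfold gradNorm
  fun_prop

/-- For almost all pairs of points `x, y` of a convex open set, the increment of a weakly
differentiable function is controlled by its weak derivative on the segment between them. -/
theorem ae_ae_enorm_sub_le {S : Set Plane} (hSo : IsOpen S) (hSc : Convex ℝ S)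
    {u : Plane → ℝ} (hum : Measurable u) {g : Fin 2 → Plane → ℝ} (hgm : ∀ i, Measurable (g i))
    (hw : ∀ i, HasWeakPartialDeriv S i u (g i)) :
    ∀ᵐ x, ∀ᵐ y, x ∈ S → y ∈ S → ‖u y - u x‖ₑ ≤
      ∫⁻ t in Ioc (0 : ℝ) 1, gradNorm g (x + t • (y - x)) * ‖y - x‖ₑ := by
  have hGm := measurable_gradNorm hgm
  have hmeas : Measurable fun p : Plane × Plane =>
      ∫⁻ t in Ioc (0 : ℝ) 1, gradNorm g (p.2 + t • p.1) * ‖p.1‖ₑ := by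
    apply Measurable.lintegral_prod_right'
      (f := fun q : (Plane × Plane) × ℝ => gradNorm g (q.1.2 + q.2 • q.1.1) * ‖q.1.1‖ₑ)
    exact (hGm.comp (by fun_prop)).mul (by fun_prop)
  have h1 : ∀ᵐ h : Plane, ∀ᵐ x : Plane, x ∈ S → x + h ∈ S → ‖u (x + h) - u x‖ₑ ≤
      ∫⁻ t in Ioc (0 : ℝ) 1, gradNorm g (x + t • h) * ‖h‖ₑ := by
    refine .of_forall fun h => ?_
    filter_upwards [ae_increment_eq_integral hSo hSc hgm hw h] with x hx h1 h2
    rw [hx h1 h2]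
    refine (enorm_integral_le_lintegral_enorm _).trans (lintegral_mono fun t => ?_)
    refine (enorm_sum_le _ _).trans ?_
    rw [gradNorm, Finset.sum_mul]
    refine Finset.sum_le_sum fun i _ => ?_
    rw [enorm_mul, mul_comm]
    gcongr
    exact enorm_le_iff_norm_le.2 (PiLp.norm_apply_le h i)
  have hset : MeasurableSet {p : Plane × Plane | p.2 ∈ S → p.2 + p.1 ∈ S →
      ‖u (p.2 + p.1) - u p.2‖ₑ ≤
        ∫⁻ t in Ioc (0 : ℝ) 1, gradNorm g (p.2 + t • p.1) * ‖p.1‖ₑ} := by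
    refine MeasurableSet.imp (measurable_snd hSo.measurableSet) (MeasurableSet.imp
      ((measurable_snd.add measurable_fst) hSo.measurableSet) (measurableSet_le ?_ hmeas))
    exact ((hum.comp (measurable_snd.add measurable_fst)).sub (hum.comp measurable_snd)).enorm
  have h2 : ∀ᵐ p : Plane × Plane ∂(volume.prod volume), p.2 ∈ S → p.2 + p.1 ∈ S →
      ‖u (p.2 + p.1) - u p.2‖ₑ ≤
        ∫⁻ t in Ioc (0 : ℝ) 1, gradNorm g (p.2 + t • p.1) * ‖p.1‖ₑ :=
    (Measure.ae_prod_iff_ae_ae hset).2 h1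
  have h3 := Measure.ae_ae_of_ae_prod ((Measure.measurePreserving_swap (μ := (volume : Measure Plane))
    (ν := (volume : Measure Plane))).quasiMeasurePreserving.ae h2)
  filter_upwards [h3] with x hx
  have h4 := (measurePreserving_sub_right (volume : Measure Plane) x).quasiMeasurePreserving.ae hx
  filter_upwards [h4] with y hy hxS hyS
  simpa using hy hxS (by simpa using hyS)

/-! ### Bounds by Riesz potentials -/

theorem lintegral_comp_add_smul {φ : Plane → ℝ≥0∞} (hφ : Measurable φ) (x : Plane) {t : ℝ}
    (ht : 0 < t) : ∫⁻ y, φ (x + t • (y - x)) = ENNReal.ofReal (t ^ (-2 : ℝ)) * ∫⁻ z, φ z := by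
  have h1 : ∫⁻ y, φ (x + t • (y - x)) = ∫⁻ y : Plane, φ (x + t • y) :=
    lintegral_sub_right_eq_self (fun y => φ (x + t • y)) x
  have h2 : ∫⁻ y : Plane, φ (x + t • y) = ∫⁻ z, φ (x + z) ∂(Measure.map (t • ·) volume) := by
    exact (lintegral_map (f := fun z => φ (x + z)) (hφ.comp (by fun_prop)) (by fun_prop)).symm
  rw [h1, h2, Measure.map_addHaar_smul _ ht.ne', lintegral_smul_measure,
    lintegral_add_left_eq_self φ x, smul_eq_mul]
  congr 2
  rw [finrank_euclideanSpace_fin, abs_of_nonneg (by positivity), Real.rpow_neg ht.le]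
  norm_cast

theorem lintegral_indicator_rpow_neg_two_le {s D : ℝ} (hs : 0 < s) (hD : 0 < D) :
    ∫⁻ t in Ioc (0 : ℝ) 1, {t : ℝ | s ≤ t * D}.indicator (fun t => ENNReal.ofReal (t ^ (-2 : ℝ))) t
      ≤ ENNReal.ofReal (D * s⁻¹) := by
  have ha : 0 < s / D := by positivity
  calc _ ≤ ∫⁻ t, (Ici (s / D)).indicator (fun t => ENNReal.ofReal (t ^ (-2 : ℝ))) t := by
        refine (setLIntegral_le_lintegral _ _).trans (lintegral_mono fun t => ?_)
        refine indicator_le_indicator_of_subset ?_ (fun _ => zero_le) t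
        intro t ht
        exact (div_le_iff₀ hD).2 ht
    _ = ∫⁻ t in Ioi (s / D), ENNReal.ofReal (t ^ (-2 : ℝ)) := by
        rw [lintegral_indicator measurableSet_Ici, setLIntegral_congr Ioi_ae_eq_Ici]
    _ = ENNReal.ofReal (∫ t in Ioi (s / D), t ^ (-2 : ℝ)) := by
        rw [ofReal_integral_eq_lintegral_ofReal
          (integrableOn_Ioi_rpow_of_lt (by norm_num) ha)]
        filter_upwards [ae_restrict_mem measurableSet_Ioi] with t ht
        exact Real.rpow_nonneg (ha.trans ht).le _
    _ ≤ ENNReal.ofReal (D * s⁻¹) := by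
        rw [integral_Ioi_rpow_of_lt (by norm_num) ha]
        apply le_of_eq
        congr 1
        norm_num
        rw [Real.rpow_neg_one]
        field_simp

/-- The part of a function on the cone over `A` with vertex `x`, averaged over the segments from
`x` to the points of `A`, is bounded by its Riesz potential of order one. -/
theorem lintegral_segment_le_riesz {S A : Set Plane} (hSm : MeasurableSet S)
    {D : ℝ} (hD : 0 < D) {x : Plane} (hx : ∀ y ∈ A, dist y x ≤ D) (hAm : MeasurableSet A)
    (hseg : ∀ y ∈ A, ∀ t ∈ Ioc (0 : ℝ) 1, x + t • (y - x) ∈ S)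
    {F : Plane → ℝ≥0∞} (hF : Measurable F) :
    ∫⁻ y in A, ∫⁻ t in Ioc (0 : ℝ) 1, F (x + t • (y - x)) * ‖y - x‖ₑ ≤
      ENNReal.ofReal (D ^ 2) * ∫⁻ z in S, F z * ‖x - z‖ₑ ^ (-1 : ℝ) := by
  have hm1 : Measurable fun q : Plane × ℝ => F (x + q.2 • (q.1 - x)) * ‖q.1 - x‖ₑ :=
    (hF.comp (by fun_prop)).mul (by fun_prop)
  have hKm : MeasurableSet {q : Plane × ℝ | dist q.1 x ≤ q.2 * D} :=
    measurableSet_le (by fun_prop) (by fun_prop)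
  set Φ : ℝ → Plane → ℝ≥0∞ := fun t z =>
    S.indicator F z * {q : Plane × ℝ | dist q.1 x ≤ q.2 * D}.indicator 1 (z, t) with hΦ
  have hΦm : Measurable fun q : Plane × ℝ => Φ q.2 q.1 :=
    ((hF.indicator hSm).comp measurable_fst).mul (measurable_one.indicator hKm)
  have hΦm' : ∀ t, Measurable (Φ t) := fun t =>
    hΦm.comp (measurable_id.prodMk measurable_const)
  calc ∫⁻ y in A, ∫⁻ t in Ioc (0 : ℝ) 1, F (x + t • (y - x)) * ‖y - x‖ₑ
      = ∫⁻ t in Ioc (0 : ℝ) 1, ∫⁻ y in A, F (x + t • (y - x)) * ‖y - x‖ₑ :=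
        lintegral_lintegral_swap hm1.aemeasurable
    _ ≤ ∫⁻ t in Ioc (0 : ℝ) 1, ∫⁻ y, ENNReal.ofReal D * Φ t (x + t • (y - x)) := by
        refine setLIntegral_mono' measurableSet_Ioc fun t ht => ?_
        rw [← lintegral_indicator hAm]
        refine lintegral_mono fun y => ?_
        by_cases hy : y ∈ A
        · have h1 : dist (x + t • (y - x)) x ≤ t * D := by
            rw [dist_eq_norm, add_sub_cancel_left, norm_smul, Real.norm_of_nonneg ht.1.le,
              ← dist_eq_norm]
            exact mul_le_mul_of_nonneg_left (hx y hy) ht.1.le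
          have h2 : ‖y - x‖ₑ ≤ ENNReal.ofReal D := by
            rw [← ofReal_norm, ← dist_eq_norm]
            exact ENNReal.ofReal_le_ofReal (hx y hy)
          simp only [indicator_of_mem hy, hΦ, indicator_of_mem (hseg y hy t ht)]
          rw [indicator_of_mem (by exact h1)]
          simp only [Pi.one_apply, mul_one]
          rw [mul_comm]
          gcongr
        · simp [hy]
    _ = ∫⁻ t in Ioc (0 : ℝ) 1, ENNReal.ofReal D *
          (ENNReal.ofReal (t ^ (-2 : ℝ)) * ∫⁻ z, Φ t z) := by
        refine setLIntegral_congr_fun measurableSet_Ioc fun t ht => ?_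
        rw [lintegral_const_mul' _ _ ENNReal.ofReal_ne_top,
          lintegral_comp_add_smul (hΦm' t) x ht.1]
    _ = ENNReal.ofReal D * ∫⁻ t in Ioc (0 : ℝ) 1, ∫⁻ z, ENNReal.ofReal (t ^ (-2 : ℝ)) * Φ t z := by
        rw [lintegral_const_mul']
        · simp_rw [lintegral_const_mul _ (hΦm' _)]
        · simp
    _ = ENNReal.ofReal D * ∫⁻ z, ∫⁻ t in Ioc (0 : ℝ) 1, ENNReal.ofReal (t ^ (-2 : ℝ)) * Φ t z := by
        congr 1
        apply lintegral_lintegral_swap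
        apply Measurable.aemeasurable
        exact (by fun_prop : Measurable fun q : ℝ × Plane => ENNReal.ofReal (q.1 ^ (-2 : ℝ))).mul
          (hΦm.comp measurable_swap)
    _ ≤ ENNReal.ofReal D * ∫⁻ z, S.indicator
          (fun z => ENNReal.ofReal D * (F z * ‖x - z‖ₑ ^ (-1 : ℝ))) z := by
        gcongr with z
        by_cases hz : z ∈ S
        · simp only [indicator_of_mem hz, hΦ]
          rcases eq_or_ne x z with rfl | hxz
          · rcases eq_or_ne (F x) 0 with h0 | h0
            · simp [h0]
            · simp [h0, hD]
          have hs : 0 < dist z x := dist_pos.2 hxz.symm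
          have := lintegral_indicator_rpow_neg_two_le hs hD
          calc ∫⁻ t in Ioc (0 : ℝ) 1, ENNReal.ofReal (t ^ (-2 : ℝ)) *
                (F z * {q : Plane × ℝ | dist q.1 x ≤ q.2 * D}.indicator 1 (z, t))
              = ∫⁻ t in Ioc (0 : ℝ) 1, F z * {t : ℝ | dist z x ≤ t * D}.indicator
                  (fun t => ENNReal.ofReal (t ^ (-2 : ℝ))) t := by
                refine lintegral_congr fun t => ?_
                by_cases h : dist z x ≤ t * D <;> simp [indicator, mul_comm]
            _ = F z * ∫⁻ t in Ioc (0 : ℝ) 1, {t : ℝ | dist z x ≤ t * D}.indicator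
                  (fun t => ENNReal.ofReal (t ^ (-2 : ℝ))) t := by
                apply lintegral_const_mul
                exact (by fun_prop : Measurable fun t : ℝ => ENNReal.ofReal (t ^ (-2 : ℝ))).indicator
                  (measurableSet_le (by fun_prop) (by fun_prop))
            _ ≤ F z * ENNReal.ofReal (D * (dist z x)⁻¹) := by gcongr
            _ = ENNReal.ofReal D * (F z * ‖x - z‖ₑ ^ (-1 : ℝ)) := by
                rw [ENNReal.ofReal_mul hD.le, ENNReal.ofReal_inv_of_pos hs, dist_comm,
                  dist_eq_norm, ofReal_norm, ENNReal.rpow_neg_one]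
                ring
        · simp [hΦ, hz]
    _ = ENNReal.ofReal (D ^ 2) * ∫⁻ z in S, F z * ‖x - z‖ₑ ^ (-1 : ℝ) := by
        rw [lintegral_indicator hSm, lintegral_const_mul' _ _ (by simp), ← mul_assoc,
          ← ENNReal.ofReal_mul hD.le, sq]

/-- A weighted Poincaré inequality in pointwise form: `W |u|` is bounded by a constant and the
Riesz potential of `W |∇u|` when the weight does not drop along the segments that lead from the
points of `S` into `A`. -/
theorem ae_weight_mul_enorm_le {S A : Set Plane} (hSo : IsOpen S) (hSc : Convex ℝ S)
    (hAS : A ⊆ S) (hAm : MeasurableSet A) {D : ℝ} (hD : 0 < D)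
    (hdiam : ∀ x ∈ S, ∀ y ∈ S, dist y x ≤ D)
    {W : Plane → ℝ≥0∞} (hWm : Measurable W) {C : ℝ≥0∞}
    (hW : ∀ x ∈ S, ∀ y ∈ A, ∀ t ∈ Ioc (0 : ℝ) 1, W x ≤ C * W (x + t • (y - x)))
    {u : Plane → ℝ} (hum : Measurable u) {g : Fin 2 → Plane → ℝ} (hgm : ∀ i, Measurable (g i))
    (hw : ∀ i, HasWeakPartialDeriv S i u (g i)) :
    ∀ᵐ x, x ∈ S → W x * ‖u x‖ₑ * volume A ≤ W x * (∫⁻ y in A, ‖u y‖ₑ) +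
      C * (ENNReal.ofReal (D ^ 2) *
        ∫⁻ z in S, W z * gradNorm g z * ‖x - z‖ₑ ^ (-1 : ℝ)) := by
  have hGm := measurable_gradNorm hgm
  filter_upwards [ae_ae_enorm_sub_le hSo hSc hum hgm hw] with x hx hxS
  have hseg : ∀ y ∈ A, ∀ t ∈ Ioc (0 : ℝ) 1, x + t • (y - x) ∈ S := fun y hy t ht =>
    hSc.add_smul_sub_mem hxS (hAS hy) (Ioc_subset_Icc_self ht)
  have h1 : ∀ᵐ y ∂(volume.restrict A), W x * ‖u x‖ₑ ≤ W x * ‖u y‖ₑ +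
      C * ∫⁻ t in Ioc (0 : ℝ) 1,
        (W (x + t • (y - x)) * gradNorm g (x + t • (y - x))) * ‖y - x‖ₑ := by
    filter_upwards [ae_restrict_mem hAm, ae_restrict_of_ae hx] with y hyA hy
    have e1 : ‖u x‖ₑ ≤ ‖u y‖ₑ + ‖u y - u x‖ₑ := by
      calc ‖u x‖ₑ = ‖u y - (u y - u x)‖ₑ := by congr 1; ring
        _ ≤ _ := enorm_sub_le
    have hm : Measurable fun t : ℝ => W (x + t • (y - x)) * gradNorm g (x + t • (y - x)) * ‖y - x‖ₑ :=
      ((hWm.comp (by fun_prop)).mul (hGm.comp (by fun_prop))).mul_const _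
    have hm' : Measurable fun t : ℝ => gradNorm g (x + t • (y - x)) * ‖y - x‖ₑ :=
      (hGm.comp (by fun_prop)).mul_const _
    calc W x * ‖u x‖ₑ ≤ W x * (‖u y‖ₑ + ∫⁻ t in Ioc (0 : ℝ) 1,
          gradNorm g (x + t • (y - x)) * ‖y - x‖ₑ) := by
          gcongr
          exact e1.trans (by gcongr; exact hy hxS (hAS hyA))
      _ = W x * ‖u y‖ₑ + ∫⁻ t in Ioc (0 : ℝ) 1,
          W x * (gradNorm g (x + t • (y - x)) * ‖y - x‖ₑ) := by
          rw [mul_add, lintegral_const_mul _ hm']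
      _ ≤ _ := by
          rw [← lintegral_const_mul _ hm]
          refine add_le_add le_rfl (setLIntegral_mono' measurableSet_Ioc fun t ht => ?_)
          rw [← mul_assoc, ← mul_assoc, ← mul_assoc]
          gcongr
          exact hW x hxS y hyA t ht
  calc W x * ‖u x‖ₑ * volume A = ∫⁻ _ in A, W x * ‖u x‖ₑ := by simp
    _ ≤ ∫⁻ y in A, (W x * ‖u y‖ₑ + C * ∫⁻ t in Ioc (0 : ℝ) 1,
        (W (x + t • (y - x)) * gradNorm g (x + t • (y - x))) * ‖y - x‖ₑ) := lintegral_mono_ae h1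
    _ = W x * (∫⁻ y in A, ‖u y‖ₑ) + C * ∫⁻ y in A, ∫⁻ t in Ioc (0 : ℝ) 1,
        (W (x + t • (y - x)) * gradNorm g (x + t • (y - x))) * ‖y - x‖ₑ := by
        rw [lintegral_add_left (hum.enorm.const_mul _), lintegral_const_mul _ hum.enorm,
          lintegral_const_mul]
        apply Measurable.lintegral_prod_right' (f := fun q : Plane × ℝ =>
          (W (x + q.2 • (q.1 - x)) * gradNorm g (x + q.2 • (q.1 - x))) * ‖q.1 - x‖ₑ)
        exact ((hWm.comp (by fun_prop)).mul (hGm.comp (by fun_prop))).mul (by fun_prop)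
    _ ≤ _ := by
        gcongr
        exact lintegral_segment_le_riesz hSo.measurableSet hD
          (fun y hy => hdiam x hxS y (hAS hy)) hAm hseg (F := fun z => W z * gradNorm g z)
          (hWm.mul hGm)

/-! ### Integrability of Riesz potentials -/

theorem lintegral_ball_enorm_rpow_lt_top {κ : ℝ} (hκ : κ < 2) (D : ℝ) :
    ∫⁻ z : Plane in Metric.ball 0 D, ‖z‖ₑ ^ (-κ) < ⊤ := by
  have h : IntegrableOn (fun z : Plane => ‖z‖ ^ (-κ)) (Metric.ball 0 D) := by
    refine integrableOn_ball_of_norm_le_rpow (C := 1) (α := κ) (by simp) (by simpa using hκ) ?_ ?_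
    · refine .of_forall fun z => ?_
      rw [one_mul, Real.norm_of_nonneg (Real.rpow_nonneg (norm_nonneg _) _)]
    · exact (by fun_prop : Measurable fun z : Plane => ‖z‖ ^ (-κ)).aestronglyMeasurable
  refine lt_of_le_of_lt (le_of_eq ?_) h.2
  refine lintegral_congr_ae (ae_restrict_of_ae ?_)
  have h0 : ∀ᵐ z : Plane, z ≠ 0 := by simp [ae_iff]
  filter_upwards [h0] with z hz
  have hz' : 0 < ‖z‖ := norm_pos_iff.2 hz
  rw [Real.enorm_eq_ofReal (Real.rpow_nonneg (norm_nonneg _) _),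
    ← ENNReal.ofReal_rpow_of_pos hz', ofReal_norm]

/-- The singular kernels `|x - z| ^ (-κ)`, `κ < 2`, are integrable over bounded sets, uniformly
in the pole. -/
theorem exists_lintegral_enorm_sub_rpow_le {κ : ℝ} (hκ : κ < 2) {S : Set Plane}
    {D : ℝ} (hS : ∀ x ∈ S, ∀ y ∈ S, dist y x ≤ D) :
    ∃ C : ℝ≥0∞, C ≠ ⊤ ∧ ∀ x ∈ S, ∫⁻ z in S, ‖x - z‖ₑ ^ (-κ) ≤ C := by
  refine ⟨_, (lintegral_ball_enorm_rpow_lt_top hκ (D + 1)).ne, fun x hx => ?_⟩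
  have e : ∫⁻ z : Plane in Metric.ball 0 (D + 1), ‖z‖ₑ ^ (-κ) =
      ∫⁻ z : Plane in Metric.ball x (D + 1), ‖x - z‖ₑ ^ (-κ) := by
    rw [← lintegral_indicator Metric.isOpen_ball.measurableSet,
      ← lintegral_indicator Metric.isOpen_ball.measurableSet,
      ← lintegral_sub_left_eq_self _ x]
    refine lintegral_congr fun z => ?_
    simp [indicator, dist_eq_norm, norm_sub_rev]
  rw [e]
  refine lintegral_mono_set fun z hz => ?_
  rw [Metric.mem_ball]
  linarith [hS x hx z hz]

/-- The Riesz potential of a function in `L^δ`, `δ > 2`, is bounded on bounded sets. -/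
theorem exists_riesz_le {S : Set Plane} {D : ℝ} (hS : ∀ x ∈ S, ∀ y ∈ S, dist y x ≤ D)
    {δ : ℝ} (hδ : 2 < δ) :
    ∃ C : ℝ≥0∞, C ≠ ⊤ ∧ ∀ F : Plane → ℝ≥0∞, Measurable F → ∀ x ∈ S,
      ∫⁻ z in S, F z * ‖x - z‖ₑ ^ (-1 : ℝ) ≤ (∫⁻ z in S, F z ^ δ) ^ (1 / δ) * C := by
  have hc : δ.HolderConjugate (δ / (δ - 1)) := Real.HolderConjugate.conjExponent (by linarith)
  have hκ : δ / (δ - 1) < 2 := by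
    rw [div_lt_iff₀ (by linarith)]; linarith
  obtain ⟨C, hC, h⟩ := exists_lintegral_enorm_sub_rpow_le hκ hS
  refine ⟨C ^ (1 / (δ / (δ - 1))), ENNReal.rpow_ne_top_of_nonneg (by
    have := hc.symm.pos; positivity) hC, fun F hF x hx => ?_⟩
  refine (ENNReal.lintegral_mul_le_Lp_mul_Lq _ hc hF.aemeasurable
    (by fun_prop : Measurable fun z : Plane => ‖x - z‖ₑ ^ (-1 : ℝ)).aemeasurable).trans ?_
  have : ∀ z : Plane, (‖x - z‖ₑ ^ (-1 : ℝ)) ^ (δ / (δ - 1)) = ‖x - z‖ₑ ^ (-(δ / (δ - 1))) := by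
    intro z; rw [← ENNReal.rpow_mul]; congr 1; ring
  simp_rw [this]
  have := hc.symm.pos
  gcongr
  exact h x hx

/-- The product of a function `H` in `L^δ` and of the Riesz potential of a function `F` in `L^q` is
in `L^q`, for `δ > max 2 q`. -/
theorem exists_lintegral_mul_riesz_rpow_le {S : Set Plane} (hSm : MeasurableSet S) {D : ℝ}
    (hS : ∀ x ∈ S, ∀ y ∈ S, dist y x ≤ D) {q δ : ℝ} (hq : 1 < q) (hδ : 2 < δ) (hqδ : q < δ) :
    ∃ C : ℝ≥0∞, C ≠ ⊤ ∧ ∀ F H : Plane → ℝ≥0∞, Measurable F → Measurable H →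
      ∫⁻ x in S, (H x * ∫⁻ z in S, F z * ‖x - z‖ₑ ^ (-1 : ℝ)) ^ q ≤
        C * ((∫⁻ z in S, F z ^ q) * (∫⁻ x in S, H x ^ δ) ^ (q / δ)) := by
  have hq0 : 0 < q := by linarith
  have hδ0 : 0 < δ := by linarith
  -- the kernel is split as `|x - z| ^ (-a) * |x - z| ^ (-(1 - a))`; each of the two
  -- applications of Hölder's inequality below bounds `a` from one side
  obtain ⟨a, ha1, ha2⟩ : ∃ a : ℝ, max 0 (2 / q - 1) < a ∧ a < min 1 (2 / q - 2 / δ) := by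
    apply exists_between
    have h1 : 2 / δ < 1 := by rw [div_lt_one hδ0]; exact hδ
    have h2 : 2 / δ < 2 / q := by gcongr
    have h3 : 2 / q < 2 := by rw [div_lt_iff₀ hq0]; linarith
    rw [lt_min_iff, max_lt_iff, max_lt_iff]
    refine ⟨⟨by norm_num, by linarith⟩, ⟨by linarith, by linarith⟩⟩
  rw [max_lt_iff] at ha1
  rw [lt_min_iff] at ha2
  have hc : q.HolderConjugate (q / (q - 1)) := Real.HolderConjugate.conjExponent hq
  have hδq : 1 < δ / q := by rwa [one_lt_div hq0]
  have hc2 : (δ / q).HolderConjugate ((δ / q) / (δ / q - 1)) :=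
    Real.HolderConjugate.conjExponent hδq
  set q' := q / (q - 1) with hq'
  set r := (δ / q) / (δ / q - 1) with hr
  have hκ1 : (1 - a) * q' < 2 := by
    have h1 : 2 / q < a + 1 := by linarith
    rw [div_lt_iff₀ hq0] at h1
    rw [hq', ← mul_div_assoc, div_lt_iff₀ (by linarith)]
    nlinarith
  have hκ2 : a * q * r < 2 := by
    have h1 : a < 2 * (δ - q) / (q * δ) := by
      refine ha2.2.trans_eq ?_
      field_simp
    rw [lt_div_iff₀ (by positivity)] at h1
    have h2 : r = δ / (δ - q) := by
      have : δ - q ≠ 0 := by linarith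
      rw [hr]; field_simp
    rw [h2, ← mul_div_assoc, div_lt_iff₀ (by linarith)]
    linarith
  obtain ⟨C1, hC1, h1⟩ := exists_lintegral_enorm_sub_rpow_le hκ1 hS
  obtain ⟨C2, hC2, h2⟩ := exists_lintegral_enorm_sub_rpow_le hκ2 hS
  have hq'0 := hc.symm.pos
  have hr0 := hc2.symm.pos
  have hC1' : (C1 ^ (1 / q')) ^ q ≠ ⊤ := ENNReal.rpow_ne_top_of_nonneg hq0.le
    (ENNReal.rpow_ne_top_of_nonneg (by positivity) hC1)
  refine ⟨(C1 ^ (1 / q')) ^ q * C2 ^ (1 / r), ENNReal.mul_ne_top hC1'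
    (ENNReal.rpow_ne_top_of_nonneg (by positivity) hC2), fun F H hF hH => ?_⟩
  have hKm : ∀ s : ℝ, Measurable fun p : Plane × Plane => ‖p.1 - p.2‖ₑ ^ s := fun s => by fun_prop
  have hF' : ∀ x, Measurable fun z => F z ^ q * ‖x - z‖ₑ ^ (-(a * q)) := fun x =>
    Measurable.mul (hF.pow_const q) (by fun_prop)
  have hH' : ∀ z, Measurable fun x => H x ^ q * ‖x - z‖ₑ ^ (-(a * q)) := fun z =>
    Measurable.mul (hH.pow_const q) (by fun_prop)
  have step1 : ∀ x ∈ S, (∫⁻ z in S, F z * ‖x - z‖ₑ ^ (-1 : ℝ)) ^ q ≤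
      (C1 ^ (1 / q')) ^ q * ∫⁻ z in S, F z ^ q * ‖x - z‖ₑ ^ (-(a * q)) := by
    intro x hx
    have split : ∀ z, F z * ‖x - z‖ₑ ^ (-1 : ℝ) =
        (F z * ‖x - z‖ₑ ^ (-a)) * ‖x - z‖ₑ ^ (-(1 - a)) := by
      intro z
      rw [mul_assoc]
      congr 1
      rcases eq_or_ne x z with rfl | hxz
      · rw [sub_self, enorm_zero, ENNReal.zero_rpow_of_neg (by norm_num),
          ENNReal.zero_rpow_of_neg (by linarith), ENNReal.zero_rpow_of_neg (by linarith)]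
        simp
      · rw [← ENNReal.rpow_add _ _ (by simpa [sub_eq_zero] using hxz) enorm_ne_top]
        congr 1; ring
    have hol := ENNReal.lintegral_mul_le_Lp_mul_Lq (volume.restrict S) hc
      (f := fun z => F z * ‖x - z‖ₑ ^ (-a)) (g := fun z => ‖x - z‖ₑ ^ (-(1 - a)))
      (hF.mul (by fun_prop)).aemeasurable (by fun_prop)
    simp only [Pi.mul_apply] at hol
    simp_rw [split]
    calc _ ≤ ((∫⁻ z in S, (F z * ‖x - z‖ₑ ^ (-a)) ^ q) ^ (1 / q) * C1 ^ (1 / q')) ^ q := by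
          refine ENNReal.rpow_le_rpow (hol.trans ?_) hq0.le
          refine mul_le_mul_right (ENNReal.rpow_le_rpow ?_ (by positivity)) _
          refine le_trans (le_of_eq ?_) (h1 x hx)
          refine lintegral_congr fun z => ?_
          rw [← ENNReal.rpow_mul]; congr 1; ring
      _ = _ := by
          rw [ENNReal.mul_rpow_of_nonneg _ _ hq0.le, ← ENNReal.rpow_mul, one_div_mul_cancel hq0.ne',
            ENNReal.rpow_one, mul_comm]
          congr 1
          refine lintegral_congr fun z => ?_
          rw [ENNReal.mul_rpow_of_nonneg _ _ hq0.le, ← ENNReal.rpow_mul]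
          congr 2; ring
  have hm : Measurable fun p : Plane × Plane =>
      H p.1 ^ q * (F p.2 ^ q * ‖p.1 - p.2‖ₑ ^ (-(a * q))) :=
    ((hH.comp measurable_fst).pow_const q).mul
      (((hF.comp measurable_snd).pow_const q).mul (hKm _))
  have step2 : ∀ z ∈ S, ∫⁻ x in S, H x ^ q * ‖x - z‖ₑ ^ (-(a * q)) ≤
      (∫⁻ x in S, H x ^ δ) ^ (q / δ) * C2 ^ (1 / r) := by
    intro z hz
    have hol := ENNReal.lintegral_mul_le_Lp_mul_Lq (volume.restrict S) hc2
      (f := fun x => H x ^ q) (g := fun x => ‖x - z‖ₑ ^ (-(a * q)))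
      (hH.pow_const q).aemeasurable (by fun_prop)
    refine hol.trans (mul_le_mul' (le_of_eq ?_) (ENNReal.rpow_le_rpow ?_ (by positivity)))
    · rw [one_div_div]
      congr 1
      refine lintegral_congr fun x => ?_
      rw [← ENNReal.rpow_mul, mul_div_cancel₀ _ hq0.ne']
    · refine le_trans (le_of_eq ?_) (h2 z hz)
      refine lintegral_congr fun x => ?_
      rw [← ENNReal.rpow_mul, ← enorm_neg, neg_sub]
      congr 1; ring
  calc ∫⁻ x in S, (H x * ∫⁻ z in S, F z * ‖x - z‖ₑ ^ (-1 : ℝ)) ^ q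
      ≤ ∫⁻ x in S, (C1 ^ (1 / q')) ^ q *
          ∫⁻ z in S, H x ^ q * (F z ^ q * ‖x - z‖ₑ ^ (-(a * q))) := by
        refine setLIntegral_mono' hSm fun x hx => ?_
        rw [ENNReal.mul_rpow_of_nonneg _ _ hq0.le, lintegral_const_mul _ (hF' x), mul_left_comm]
        gcongr
        exact step1 x hx
    _ = (C1 ^ (1 / q')) ^ q *
          ∫⁻ x in S, ∫⁻ z in S, H x ^ q * (F z ^ q * ‖x - z‖ₑ ^ (-(a * q))) := by
        rw [lintegral_const_mul' _ _ hC1']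
    _ = (C1 ^ (1 / q')) ^ q *
          ∫⁻ z in S, ∫⁻ x in S, H x ^ q * (F z ^ q * ‖x - z‖ₑ ^ (-(a * q))) := by
        rw [lintegral_lintegral_swap hm.aemeasurable]
    _ ≤ (C1 ^ (1 / q')) ^ q *
          ∫⁻ z in S, F z ^ q * ((∫⁻ x in S, H x ^ δ) ^ (q / δ) * C2 ^ (1 / r)) := by
        refine mul_le_mul_right (setLIntegral_mono' hSm fun z hz => ?_) _
        simp_rw [mul_left_comm (H _ ^ q)]
        rw [lintegral_const_mul _ (hH' z)]
        gcongr
        exact step2 z hz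
    _ = _ := by
        rw [lintegral_mul_const _ (hF.pow_const q)]
        ring

/-! ### Morrey and weighted Sobolev inequalities in convex sets -/

/-- The pointwise estimate from which both embeddings follow: `W |u|` is bounded by an affine
function of the Riesz potential of `W |∇u|`, with finite constants. -/
theorem exists_weight_mul_enorm_le {S A : Set Plane} (hSo : IsOpen S) (hSc : Convex ℝ S)
    (hAS : A ⊆ S) (hAc : IsCompact A) (hA0 : volume A ≠ 0) {D : ℝ} (hD : 0 < D)
    (hdiam : ∀ x ∈ S, ∀ y ∈ S, dist y x ≤ D)
    {W : Plane → ℝ≥0∞} (hWm : Measurable W) {B : ℝ≥0∞} (hB : B ≠ ⊤) (hWB : ∀ x ∈ S, W x ≤ B)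
    {C : ℝ≥0∞} (hC : C ≠ ⊤)
    (hW : ∀ x ∈ S, ∀ y ∈ A, ∀ t ∈ Ioc (0 : ℝ) 1, W x ≤ C * W (x + t • (y - x)))
    {u : Plane → ℝ} (hum : Measurable u) {g : Fin 2 → Plane → ℝ} (hgm : ∀ i, Measurable (g i))
    (hw : ∀ i, HasWeakPartialDeriv S i u (g i)) :
    ∃ c₀ c₁ : ℝ≥0∞, c₀ ≠ ⊤ ∧ c₁ ≠ ⊤ ∧ ∀ᵐ x, x ∈ S → W x * ‖u x‖ₑ ≤
      c₀ + c₁ * ∫⁻ z in S, W z * gradNorm g z * ‖x - z‖ₑ ^ (-1 : ℝ) := by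
  have hAi : ∫⁻ y in A, ‖u y‖ₑ ≠ ⊤ :=
    ((locallyIntegrableOn_iff hSo.isLocallyClosed).1 (hw 0).1 A hAS hAc).2.ne
  have hAt : volume A ≠ ⊤ := hAc.measure_lt_top.ne
  refine ⟨B * (∫⁻ y in A, ‖u y‖ₑ) * (volume A)⁻¹, C * ENNReal.ofReal (D ^ 2) * (volume A)⁻¹,
    ENNReal.mul_ne_top (ENNReal.mul_ne_top hB hAi) (ENNReal.inv_ne_top.2 hA0),
    ENNReal.mul_ne_top (ENNReal.mul_ne_top hC ENNReal.ofReal_ne_top) (ENNReal.inv_ne_top.2 hA0),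
    ?_⟩
  filter_upwards [ae_weight_mul_enorm_le hSo hSc hAS hAc.measurableSet hD hdiam hWm hW hum hgm hw]
    with x hx hxS
  have h1 := hx hxS
  calc W x * ‖u x‖ₑ = W x * ‖u x‖ₑ * volume A * (volume A)⁻¹ := by
        rw [mul_assoc _ (volume A), ENNReal.mul_inv_cancel hA0 hAt, mul_one]
    _ ≤ (B * (∫⁻ y in A, ‖u y‖ₑ) + C * (ENNReal.ofReal (D ^ 2) *
        ∫⁻ z in S, W z * gradNorm g z * ‖x - z‖ₑ ^ (-1 : ℝ))) * (volume A)⁻¹ := by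
        gcongr
        exact h1.trans (by gcongr; exact hWB x hxS)
    _ = _ := by ring

/-- Morrey's inequality in convex sets. -/
theorem exists_enorm_le_of_convex {S : Set Plane} (hSo : IsOpen S) (hSc : Convex ℝ S)
    (hSn : S.Nonempty) {D : ℝ} (hD : 0 < D) (hdiam : ∀ x ∈ S, ∀ y ∈ S, dist y x ≤ D)
    {u : Plane → ℝ} (hum : Measurable u) {g : Fin 2 → Plane → ℝ} (hgm : ∀ i, Measurable (g i))
    (hw : ∀ i, HasWeakPartialDeriv S i u (g i)) {δ : ℝ} (hδ : 2 < δ)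
    (hg : ∫⁻ z in S, gradNorm g z ^ δ ≠ ⊤) :
    ∃ M : ℝ≥0∞, M ≠ ⊤ ∧ ∀ᵐ x, x ∈ S → ‖u x‖ₑ ≤ M := by
  obtain ⟨c, hc⟩ := hSn
  obtain ⟨ρ, hρ, hρS⟩ := Metric.nhds_basis_closedBall.mem_iff.1 (hSo.mem_nhds hc)
  obtain ⟨c₀, c₁, hc₀, hc₁, h⟩ := exists_weight_mul_enorm_le (W := fun _ => 1) (B := 1) (C := 1)
    hSo hSc hρS (isCompact_closedBall c ρ) (Metric.measure_closedBall_pos _ _ hρ).ne' hD hdiam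
    measurable_const (by simp) (by simp) (by simp) (by simp) hum hgm hw
  obtain ⟨C, hC, hr⟩ := exists_riesz_le hdiam hδ
  refine ⟨c₀ + c₁ * ((∫⁻ z in S, gradNorm g z ^ δ) ^ (1 / δ) * C), ?_, ?_⟩
  · refine ENNReal.add_ne_top.2 ⟨hc₀, ENNReal.mul_ne_top hc₁ (ENNReal.mul_ne_top ?_ hC)⟩
    exact ENNReal.rpow_ne_top_of_nonneg (by positivity) hg
  · filter_upwards [h] with x hx hxS
    have := hx hxS
    simp only [one_mul] at this
    refine this.trans ?_
    gcongr
    exact hr _ (measurable_gradNorm hgm) x hxS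

theorem lintegral_rpow_le_rpow_lintegral {S : Set Plane} {q δ : ℝ} (hq : 0 < q) (hqδ : q < δ)
    {H : Plane → ℝ≥0∞} (hH : Measurable H) :
    ∫⁻ x in S, H x ^ q ≤
      volume S ^ (1 / ((δ / q) / (δ / q - 1))) * (∫⁻ x in S, H x ^ δ) ^ (q / δ) := by
  have hδq : 1 < δ / q := by rwa [one_lt_div hq]
  have hc2 : (δ / q).HolderConjugate ((δ / q) / (δ / q - 1)) :=
    Real.HolderConjugate.conjExponent hδq
  have := ENNReal.lintegral_mul_le_Lp_mul_Lq (volume.restrict S) hc2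
    (f := fun x => H x ^ q) (g := fun _ => 1) (hH.pow_const q).aemeasurable (by fun_prop)
  simp only [Pi.mul_apply, mul_one, ENNReal.one_rpow, lintegral_const, one_mul,
    Measure.restrict_apply_univ, one_div_div, ← ENNReal.rpow_mul, mul_div_cancel₀ δ hq.ne'] at this
  rw [one_div_div]
  exact this.trans_eq (mul_comm _ _)

/-- The weighted Sobolev inequality in convex sets, in the dual form of a bound for products. -/
theorem exists_lintegral_mul_weight_rpow_le {S A : Set Plane} (hSo : IsOpen S) (hSc : Convex ℝ S)
    (hAS : A ⊆ S) (hAc : IsCompact A) (hA0 : volume A ≠ 0) {D : ℝ} (hD : 0 < D)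
    (hdiam : ∀ x ∈ S, ∀ y ∈ S, dist y x ≤ D) (hSf : volume S ≠ ⊤)
    {W : Plane → ℝ≥0∞} (hWm : Measurable W) {B : ℝ≥0∞} (hB : B ≠ ⊤) (hWB : ∀ x ∈ S, W x ≤ B)
    {C : ℝ≥0∞} (hC : C ≠ ⊤)
    (hW : ∀ x ∈ S, ∀ y ∈ A, ∀ t ∈ Ioc (0 : ℝ) 1, W x ≤ C * W (x + t • (y - x)))
    {u : Plane → ℝ} (hum : Measurable u) {g : Fin 2 → Plane → ℝ} (hgm : ∀ i, Measurable (g i))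
    (hw : ∀ i, HasWeakPartialDeriv S i u (g i)) {q δ : ℝ} (hq : 1 < q) (hδ : 2 < δ) (hqδ : q < δ)
    (hg : ∫⁻ z in S, (W z * gradNorm g z) ^ q ≠ ⊤) :
    ∃ M : ℝ≥0∞, M ≠ ⊤ ∧ ∀ H : Plane → ℝ≥0∞, Measurable H →
      ∫⁻ x in S, (H x * (W x * ‖u x‖ₑ)) ^ q ≤ M * (∫⁻ x in S, H x ^ δ) ^ (q / δ) := by
  have hq0 : 0 < q := by linarith
  obtain ⟨c₀, c₁, hc₀, hc₁, h⟩ := exists_weight_mul_enorm_le hSo hSc hAS hAc hA0 hD hdiam hWm hB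
    hWB hC hW hum hgm hw
  obtain ⟨K, hK, hr⟩ := exists_lintegral_mul_riesz_rpow_le hSo.measurableSet hdiam hq hδ hqδ
  set V := volume S ^ (1 / ((δ / q) / (δ / q - 1)))
  have hVt : V ≠ ⊤ := by
    refine ENNReal.rpow_ne_top_of_nonneg ?_ hSf
    rw [one_div_div]
    have h1 : 1 < δ / q := by rwa [one_lt_div hq0]
    exact div_nonneg (by linarith) (by positivity)
  have hFm : Measurable fun z => W z * gradNorm g z := hWm.mul (measurable_gradNorm hgm)
  set I := ∫⁻ z in S, (W z * gradNorm g z) ^ q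
  refine ⟨2 ^ (q - 1) * (c₀ ^ q * V + c₁ ^ q * (K * I)), ?_, fun H hH => ?_⟩
  · refine ENNReal.mul_ne_top (ENNReal.rpow_ne_top_of_nonneg (by linarith) (by simp))
      (ENNReal.add_ne_top.2 ⟨ENNReal.mul_ne_top ?_ hVt, ENNReal.mul_ne_top ?_
        (ENNReal.mul_ne_top hK hg)⟩)
    · exact ENNReal.rpow_ne_top_of_nonneg hq0.le hc₀
    · exact ENNReal.rpow_ne_top_of_nonneg hq0.le hc₁
  set k : Plane → ℝ≥0∞ := fun x => ∫⁻ z in S, W z * gradNorm g z * ‖x - z‖ₑ ^ (-1 : ℝ)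
  calc ∫⁻ x in S, (H x * (W x * ‖u x‖ₑ)) ^ q
      ≤ ∫⁻ x in S, 2 ^ (q - 1) * (c₀ ^ q * H x ^ q + c₁ ^ q * (H x * k x) ^ q) := by
        refine lintegral_mono_ae ?_
        filter_upwards [ae_restrict_mem hSo.measurableSet, ae_restrict_of_ae h] with x hxS hx
        calc (H x * (W x * ‖u x‖ₑ)) ^ q ≤ (c₀ * H x + c₁ * (H x * k x)) ^ q := by
              refine ENNReal.rpow_le_rpow ?_ hq0.le
              refine (mul_le_mul_right (hx hxS) _).trans_eq ?_
              ring
          _ ≤ 2 ^ (q - 1) * ((c₀ * H x) ^ q + (c₁ * (H x * k x)) ^ q) :=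
              ENNReal.rpow_add_le_mul_rpow_add_rpow _ _ hq.le
          _ = _ := by rw [ENNReal.mul_rpow_of_nonneg c₀ _ hq0.le,
                ENNReal.mul_rpow_of_nonneg c₁ _ hq0.le]
    _ = 2 ^ (q - 1) * (c₀ ^ q * (∫⁻ x in S, H x ^ q) + c₁ ^ q * ∫⁻ x in S, (H x * k x) ^ q) := by
        rw [lintegral_const_mul' _ _ (ENNReal.rpow_ne_top_of_nonneg (by linarith) (by simp)),
          lintegral_add_left ((hH.pow_const q).const_mul _),
          lintegral_const_mul' _ _ (ENNReal.rpow_ne_top_of_nonneg hq0.le hc₀),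
          lintegral_const_mul' _ _ (ENNReal.rpow_ne_top_of_nonneg hq0.le hc₁)]
    _ ≤ 2 ^ (q - 1) * (c₀ ^ q * (V * (∫⁻ x in S, H x ^ δ) ^ (q / δ)) +
          c₁ ^ q * (K * (I * (∫⁻ x in S, H x ^ δ) ^ (q / δ)))) := by
        gcongr
        · exact lintegral_rpow_le_rpow_lintegral hq0 hqδ hH
        · exact hr _ H hFm hH
    _ = _ := by ring

/-! ### The global weight -/

/-- The product `∏ⱼ rⱼ ^ βⱼ` of the powers of the distances to the corners. Near the corner `x j` it
is comparable with `rⱼ ^ βⱼ`, so that it replaces the localised weights. -/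
noncomputable def cornerWeight {m : ℕ} (x : Fin m → Plane) (β : Fin m → ℝ) (z : Plane) : ℝ :=
  ∏ j, dist z (x j) ^ β j

theorem cornerWeight_nonneg {m : ℕ} (x : Fin m → Plane) (β : Fin m → ℝ) (z : Plane) :
    0 ≤ cornerWeight x β z :=
  Finset.prod_nonneg fun _ _ => Real.rpow_nonneg dist_nonneg _

theorem continuous_prod_dist_rpow {m : ℕ} (x : Fin m → Plane) {β : Fin m → ℝ} (hβ : ∀ j, 0 ≤ β j)
    (s : Finset (Fin m)) : Continuous fun z => ∏ j ∈ s, dist z (x j) ^ β j :=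
  continuous_finsetProd _ fun j _ =>
    (continuous_id.dist continuous_const).rpow_const fun _ => Or.inr (hβ j)

theorem continuous_cornerWeight {m : ℕ} (x : Fin m → Plane) {β : Fin m → ℝ} (hβ : ∀ j, 0 ≤ β j) :
    Continuous (cornerWeight x β) :=
  continuous_prod_dist_rpow x hβ _

/-- Near `p` the weight is comparable with a single power of the distance to `p`, and the
exponent is `0` unless `p` is a corner. -/
theorem exists_cornerWeight_bounds {m : ℕ} {x : Fin m → Plane} (hx : Function.Injective x)
    {β : Fin m → ℝ} (hβ : ∀ j, 0 ≤ β j) (p : Plane) :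
    ∃ b c C ε : ℝ, 0 ≤ b ∧ 0 < c ∧ 0 < C ∧ 0 < ε ∧ (b = 0 ∨ p ∈ range x) ∧
      ∀ z ∈ Metric.ball p ε,
        c * dist z p ^ b ≤ cornerWeight x β z ∧ cornerWeight x β z ≤ C * dist z p ^ b := by
  obtain ⟨b, v, hb, hv, hvp, hbp, hw⟩ : ∃ (b : ℝ) (v : Plane → ℝ), 0 ≤ b ∧ Continuous v ∧ 0 < v p ∧
      (b = 0 ∨ p ∈ range x) ∧ ∀ z, cornerWeight x β z = dist z p ^ b * v z := by
    by_cases hp : p ∈ range x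
    · obtain ⟨j, rfl⟩ := hp
      refine ⟨β j, _, hβ j, continuous_prod_dist_rpow x hβ (Finset.univ.erase j), ?_,
        Or.inr ⟨j, rfl⟩, fun z => ?_⟩
      · refine Finset.prod_pos fun i hi => Real.rpow_pos_of_pos (dist_pos.2 ?_) _
        exact fun h => Finset.ne_of_mem_erase hi (hx h).symm
      · exact (Finset.mul_prod_erase _ (fun j => dist z (x j) ^ β j) (Finset.mem_univ j)).symm
    · refine ⟨0, _, le_rfl, continuous_cornerWeight x hβ, ?_, Or.inl rfl, fun z => by simp⟩
      refine Finset.prod_pos fun i _ => Real.rpow_pos_of_pos (dist_pos.2 ?_) _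
      exact fun h => hp ⟨i, h.symm⟩
  have hev : ∀ᶠ z in nhds p, v p / 2 < v z ∧ v z < 2 * v p :=
    (hv.continuousAt.eventually_const_lt (by linarith)).and
      (hv.continuousAt.eventually_lt_const (by linarith))
  obtain ⟨ε, hε, hball⟩ := Metric.eventually_nhds_iff_ball.1 hev
  refine ⟨b, v p / 2, 2 * v p, ε, hb, by positivity, by positivity, hε, hbp, fun z hz => ?_⟩
  have hd : 0 ≤ dist z p ^ b := Real.rpow_nonneg dist_nonneg _
  rw [hw, mul_comm (dist z p ^ b)]
  exact ⟨mul_le_mul_of_nonneg_right (hball z hz).1.le hd,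
    mul_le_mul_of_nonneg_right (hball z hz).2.le hd⟩

/-- A convex open set that omits `p` lies on one side of a line through `p`; hence segments
from its points into a compact subset do not come much closer to `p` than their origin. -/
theorem exists_dist_le_mul_dist_of_segment {S A : Set Plane} (hSo : IsOpen S) (hSc : Convex ℝ S)
    (hAS : A ⊆ S) (hAc : IsCompact A) (hAn : A.Nonempty) {p : Plane} (hp : p ∉ S) {D : ℝ}
    (hD : 0 < D) (hdiam : ∀ x ∈ S, ∀ y ∈ S, dist y x ≤ D) :
    ∃ K : ℝ, 0 < K ∧ ∀ x ∈ S, ∀ y ∈ A, ∀ t ∈ Ioc (0 : ℝ) 1,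
      dist x p ≤ K * dist (x + t • (y - x)) p := by
  obtain ⟨f, hf⟩ := geometric_hahn_banach_point_open hSc hSo hp
  obtain ⟨y₀, hy₀, hmin⟩ := hAc.exists_isMinOn hAn f.continuous.continuousOn
  set c₀ := f y₀ - f p
  have hc₀p : 0 < c₀ := sub_pos.2 (hf y₀ (hAS hy₀))
  refine ⟨1 + D * ‖f‖ / c₀, by positivity, fun x hx y hy t ht => ?_⟩
  have h1 : t * c₀ ≤ ‖f‖ * dist (x + t • (y - x)) p := by
    calc t * c₀ ≤ (1 - t) * (f x - f p) + t * (f y - f p) := by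
          have h2 : c₀ ≤ f y - f p := sub_le_sub_right (hmin hy) _
          have h3 : 0 ≤ (1 - t) * (f x - f p) :=
            mul_nonneg (by linarith [ht.2]) (by linarith [hf x hx])
          nlinarith [ht.1]
      _ = f (x + t • (y - x) - p) := by
          simp only [map_sub, map_add, map_smul, smul_eq_mul]; ring
      _ ≤ _ := by
          rw [dist_eq_norm]
          exact (le_abs_self _).trans (f.le_opNorm _)
  have h4 : dist x p ≤ dist (x + t • (y - x)) p + t * D := by
    calc dist x p ≤ dist x (x + t • (y - x)) + dist (x + t • (y - x)) p := dist_triangle _ _ _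
      _ ≤ t * D + dist (x + t • (y - x)) p := by
          gcongr
          rw [dist_comm, dist_eq_norm, add_sub_cancel_left, norm_smul, Real.norm_of_nonneg ht.1.le,
            ← dist_eq_norm]
          exact mul_le_mul_of_nonneg_left (hdiam x hx y (hAS hy)) ht.1.le
      _ = _ := add_comm _ _
  have h5 : t * D ≤ D * ‖f‖ / c₀ * dist (x + t • (y - x)) p := by
    rw [div_mul_eq_mul_div, le_div_iff₀ hc₀p]
    nlinarith
  linarith

/-- The weight does not drop, up to a constant, along segments that lead into a fixed compact
subset of a small convex open set without corners. -/
theorem exists_cornerWeight_segment {m : ℕ} {x : Fin m → Plane} (hx : Function.Injective x)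
    {β : Fin m → ℝ} (hβ : ∀ j, 0 ≤ β j) (p : Plane) :
    ∃ ε : ℝ, 0 < ε ∧ ∀ S A : Set Plane, IsOpen S → Convex ℝ S → S ⊆ Metric.ball p ε →
      (∀ j, x j ∉ S) → A ⊆ S → IsCompact A → A.Nonempty →
      ∃ C : ℝ≥0∞, C ≠ ⊤ ∧ ∀ z ∈ S, ∀ y ∈ A, ∀ t ∈ Ioc (0 : ℝ) 1,
        ‖cornerWeight x β z‖ₑ ≤ C * ‖cornerWeight x β (z + t • (y - z))‖ₑ := by
  obtain ⟨b, c, C, ε, hb, hc, hC, hε, hbp, hw⟩ := exists_cornerWeight_bounds hx hβ p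
  refine ⟨ε, hε, fun S A hSo hSc hSb hxS hAS hAc hAn => ?_⟩
  obtain ⟨K, hK, hKd⟩ : ∃ K : ℝ, 0 < K ∧ ∀ z ∈ S, ∀ y ∈ A, ∀ t ∈ Ioc (0 : ℝ) 1,
      dist z p ^ b ≤ K * dist (z + t • (y - z)) p ^ b := by
    rcases hbp with rfl | ⟨j, rfl⟩
    · exact ⟨1, one_pos, by simp⟩
    · have hdiam : ∀ z ∈ S, ∀ y ∈ S, dist y z ≤ 2 * ε := by
        intro z hz y hy
        have h1 := Metric.mem_ball.1 (hSb hz)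
        have h2 := Metric.mem_ball.1 (hSb hy)
        linarith [dist_triangle_right y z (x j)]
      obtain ⟨K, hK, h⟩ := exists_dist_le_mul_dist_of_segment hSo hSc hAS hAc hAn (hxS j)
        (by positivity) hdiam
      refine ⟨K ^ b, by positivity, fun z hz y hy t ht => ?_⟩
      rw [← Real.mul_rpow hK.le dist_nonneg]
      exact Real.rpow_le_rpow dist_nonneg (h z hz y hy t ht) hb
  refine ⟨ENNReal.ofReal (C * K / c), ENNReal.ofReal_ne_top, fun z hz y hy t ht => ?_⟩
  have hz' : z + t • (y - z) ∈ S := hSc.add_smul_sub_mem hz (hAS hy) (Ioc_subset_Icc_self ht)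
  rw [Real.enorm_eq_ofReal (cornerWeight_nonneg _ _ _),
    Real.enorm_eq_ofReal (cornerWeight_nonneg _ _ _), ← ENNReal.ofReal_mul (by positivity)]
  refine ENNReal.ofReal_le_ofReal ?_
  calc cornerWeight x β z ≤ C * dist z p ^ b := (hw z (hSb hz)).2
    _ ≤ C * (K * dist (z + t • (y - z)) p ^ b) := by
        gcongr
        exact hKd z hz y hy t ht
    _ = C * K / c * (c * dist (z + t • (y - z)) p ^ b) := by field_simp
    _ ≤ _ := by
        gcongr
        exact (hw _ (hSb hz')).1

/-! ### Convex covers of polygonal domains -/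

theorem exists_continuousLinearMap_ne_zero_apply_eq_zero (d : Plane) :
    ∃ f : Plane →L[ℝ] ℝ, f ≠ 0 ∧ f d = 0 := by
  by_cases hd : d 0 = 0
  · refine ⟨EuclideanSpace.proj 0, fun h => ?_, by simpa using hd⟩
    have := congrArg (fun f => f (coordVec 0)) h
    simp [coordVec] at this
  · refine ⟨d 0 • EuclideanSpace.proj 1 - d 1 • EuclideanSpace.proj 0, fun h => hd ?_, ?_⟩
    · have := congrArg (fun f => f (coordVec 1)) h
      simpa [coordVec] using this
    · simp [mul_comm]

theorem volume_setOf_apply_sub_eq_zero {f : Plane →L[ℝ] ℝ} (hf : f ≠ 0) (p : Plane) :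
    volume {z | f (z - p) = 0} = 0 := by
  have h1 : volume (LinearMap.ker (f : Plane →ₗ[ℝ] ℝ) : Set Plane) = 0 := by
    refine Measure.addHaar_submodule _ _ fun h => hf ?_
    ext z
    have : z ∈ LinearMap.ker (f : Plane →ₗ[ℝ] ℝ) := by rw [h]; trivial
    simpa using this
  have h2 := measure_preimage_add_right volume (-p) (LinearMap.ker (f : Plane →ₗ[ℝ] ℝ) : Set Plane)
  rw [h1] at h2
  rw [← h2]
  simp only [← sub_eq_add_neg]
  rfl

theorem apply_sub_eq_zero_of_mem_segment {f : Plane →L[ℝ] ℝ} {a b p z : Plane}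
    (hf : f (b - a) = 0) (hp : p ∈ segment ℝ a b) (hz : z ∈ segment ℝ a b) : f (z - p) = 0 := by
  rw [segment_eq_image'] at hp hz
  obtain ⟨s, -, rfl⟩ := hp
  obtain ⟨t, -, rfl⟩ := hz
  rw [map_sub] at hf
  simp only [map_sub, map_add, map_smul, smul_eq_mul, hf]
  ring

theorem IsPolygonalDomain.vertex_notMem {m : ℕ} [NeZero m] {Ω : Set Plane}
    {x : Fin m → Plane} {om : Fin m → ℝ} (hΩ : IsPolygonalDomain Ω x om) (j : Fin m) : x j ∉ Ω := by
  have h1 : x j ∈ frontier Ω := by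
    rw [hΩ.frontier_eq]
    exact mem_iUnion.2 ⟨j, left_mem_segment ℝ _ _⟩
  intro h
  rw [hΩ.isOpen.frontier_eq] at h1
  exact h1.2 h

/-- Near any point, the lines through this point that carry sides of the polygon cut `Ω` into
finitely many convex sectors. -/
theorem IsPolygonalDomain.exists_local_cover {m : ℕ} [NeZero m] {Ω : Set Plane}
    {x : Fin m → Plane} {om : Fin m → ℝ} (hΩ : IsPolygonalDomain Ω x om) (p : Plane) {ε : ℝ}
    (hε : 0 < ε) : ∃ U ∈ nhds p, ∃ F : Set (Set Plane), F.Finite ∧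
      (∀ S ∈ F, IsOpen S ∧ Convex ℝ S ∧ S.Nonempty ∧ S ⊆ Ω ∧ S ⊆ Metric.ball p ε) ∧
      volume ((Ω ∩ U) \ ⋃₀ F) = 0 := by
  choose f hf0 hf using fun j : Fin m =>
    exists_continuousLinearMap_ne_zero_apply_eq_zero (x (j + 1) - x j)
  have hclosed : ∀ j, IsClosed (side x j) := fun j => by
    rw [side, segment_eq_image']
    exact (isCompact_Icc.image (by fun_prop)).isClosed
  have hev : ∀ᶠ z in nhds p, ∀ j, p ∉ side x j → z ∉ side x j := by
    refine Filter.eventually_all.2 fun j => ?_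
    by_cases hj : p ∈ side x j
    · simp [hj]
    · filter_upwards [(hclosed j).isOpen_compl.mem_nhds hj] with z hz _ using hz
  obtain ⟨ρ, hρ, hball⟩ := Metric.eventually_nhds_iff_ball.1 hev
  set r := min ρ ε
  have hr0 : 0 < r := lt_min hρ hε
  -- the sector in which the functional of the `j`-th line has the sign given by `τ j`
  set S : (Fin m → Bool) → Set Plane := fun τ => Metric.ball p r ∩
    ⋂ j ∈ {j | p ∈ side x j}, {z | 0 < (if τ j then (1 : ℝ) else -1) * f j (z - p)} with hS
  have hSo : ∀ τ, IsOpen (S τ) := fun τ => Metric.isOpen_ball.inter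
    ((toFinite _).isOpen_biInter fun j _ => isOpen_lt continuous_const (by fun_prop))
  have hSc : ∀ τ, Convex ℝ (S τ) := by
    refine fun τ => (convex_ball p r).inter (convex_iInter₂ fun j _ => ?_)
    intro y hy z hz a b ha hb hab
    simp only [mem_ofPred_eq, map_sub] at hy hz ⊢
    have e : (if τ j then (1 : ℝ) else -1) * (f j (a • y + b • z) - f j p) =
        a * ((if τ j then (1 : ℝ) else -1) * (f j y - f j p)) +
        b * ((if τ j then (1 : ℝ) else -1) * (f j z - f j p)) := by
      simp only [map_add, map_smul, smul_eq_mul]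
      linear_combination ((if τ j then (1 : ℝ) else -1) * f j p) * hab
    rw [e]
    rcases ha.eq_or_lt with rfl | ha'
    · have : b = 1 := by linarith
      simpa [this] using hz
    · have := mul_pos ha' hy
      have := mul_nonneg hb hz.le
      linarith
  have hSd : ∀ τ, Disjoint (S τ) (frontier Ω) := by
    refine fun τ => disjoint_left.2 fun z hz hzf => ?_
    rw [hΩ.frontier_eq] at hzf
    obtain ⟨j, hj⟩ := mem_iUnion.1 hzf
    have hzρ : z ∈ Metric.ball p ρ := Metric.ball_subset_ball (min_le_left _ _) hz.1
    by_cases hpj : p ∈ side x j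
    · have h1 := mem_iInter₂.1 hz.2 j hpj
      rw [mem_ofPred_eq, apply_sub_eq_zero_of_mem_segment (hf j) hpj hj] at h1
      simp at h1
    · exact hball z hzρ j hpj hj
  refine ⟨Metric.ball p r, Metric.ball_mem_nhds p hr0, S '' {τ | (S τ ∩ Ω).Nonempty},
    (toFinite _).image _, ?_, ?_⟩
  · rintro _ ⟨τ, hτ, rfl⟩
    refine ⟨hSo τ, hSc τ, hτ.mono inter_subset_left, ?_,
      fun z hz => Metric.ball_subset_ball (min_le_right _ _) hz.1⟩
    refine (hSc τ).isPreconnected.subset_of_closure_inter_subset hΩ.isOpen hτ ?_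
    rintro z ⟨hzc, hzS⟩
    by_contra hzΩ
    refine disjoint_left.1 (hSd τ) hzS ?_
    rw [hΩ.isOpen.frontier_eq]
    exact ⟨hzc, hzΩ⟩
  · refine measure_mono_null (t := ⋃ j, {z | f j (z - p) = 0}) ?_
      (measure_iUnion_null fun j => volume_setOf_apply_sub_eq_zero (hf0 j) p)
    rintro z ⟨⟨hzΩ, hzr⟩, hz⟩
    by_contra hne
    simp only [mem_iUnion, mem_ofPred_eq, not_exists] at hne
    have hzS : z ∈ S (fun j => decide (0 < f j (z - p))) := by
      refine ⟨hzr, mem_iInter₂.2 fun j _ => ?_⟩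
      rcases lt_or_gt_of_ne (hne j) with h | h
      · simp [h.not_gt, h, -map_sub]
      · simp [h, -map_sub]
    exact hz ⟨_, ⟨_, ⟨z, hzS, hzΩ⟩, rfl⟩, hzS⟩

/-- A polygonal domain is, up to a null set, a finite union of arbitrarily small open convex
subsets. -/
theorem IsPolygonalDomain.exists_finite_convex_cover {m : ℕ} [NeZero m] {Ω : Set Plane}
    {x : Fin m → Plane} {om : Fin m → ℝ} (hΩ : IsPolygonalDomain Ω x om)
    {ε : Plane → ℝ} (hε : ∀ p, 0 < ε p) : ∃ F : Set (Set Plane), F.Finite ∧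
      (∀ S ∈ F, IsOpen S ∧ Convex ℝ S ∧ S.Nonempty ∧ S ⊆ Ω ∧ ∃ p, S ⊆ Metric.ball p (ε p)) ∧
      volume (Ω \ ⋃₀ F) = 0 := by
  have hc : IsCompact (closure Ω) := hΩ.isBounded.isCompact_closure
  have := hc.induction_on (p := fun U => ∃ F : Set (Set Plane), F.Finite ∧
      (∀ S ∈ F, IsOpen S ∧ Convex ℝ S ∧ S.Nonempty ∧ S ⊆ Ω ∧ ∃ p, S ⊆ Metric.ball p (ε p)) ∧
      volume ((Ω ∩ U) \ ⋃₀ F) = 0) ⟨∅, finite_empty, by simp, by simp⟩ ?_ ?_ ?_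
  · obtain ⟨F, hF, hFS, h0⟩ := this
    rw [inter_eq_left.2 subset_closure] at h0
    exact ⟨F, hF, hFS, h0⟩
  · rintro s t hst ⟨F, hF, hFS, h0⟩
    exact ⟨F, hF, hFS, measure_mono_null (by gcongr) h0⟩
  · rintro s t ⟨F, hF, hFS, h0⟩ ⟨F', hF', hFS', h0'⟩
    refine ⟨F ∪ F', hF.union hF', fun S hS => hS.elim (hFS S) (hFS' S),
      measure_mono_null ?_ (measure_union_null h0 h0')⟩
    rintro z ⟨⟨hz, hzst⟩, hzn⟩
    rw [sUnion_union, mem_union, not_or] at hzn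
    exact hzst.elim (fun h => Or.inl ⟨⟨hz, h⟩, hzn.1⟩) (fun h => Or.inr ⟨⟨hz, h⟩, hzn.2⟩)
  · intro p _
    obtain ⟨U, hU, F, hF, hFS, h0⟩ := hΩ.exists_local_cover p (hε p)
    exact ⟨U, mem_nhdsWithin_of_mem_nhds hU, F, hF, fun S hS =>
      ⟨(hFS S hS).1, (hFS S hS).2.1, (hFS S hS).2.2.1, (hFS S hS).2.2.2.1, p, (hFS S hS).2.2.2.2⟩, h0⟩

/-! ### The product rule -/

/-- Translations are continuous in `L^p`, `p < ∞`. -/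
theorem tendsto_eLpNorm_translate_sub {p : ℝ≥0∞} (hp1 : 1 ≤ p) (hp : p ≠ ⊤) {f : Plane → ℝ}
    (hf : MemLp f p) :
    Filter.Tendsto (fun y => eLpNorm (fun x => f (x + y) - f x) p) (nhds 0) (nhds 0) := by
  have : Fact (1 ≤ p) := ⟨hp1⟩
  have hgm : ∀ y : Plane, MeasurePreserving (fun x => x + y) (volume : Measure Plane) volume :=
    fun y => measurePreserving_add_right volume y
  set T : Plane → C(Plane, Plane) := fun y => ⟨fun x => x + y, by fun_prop⟩
  have hTc : Continuous T := by
    apply ContinuousMap.continuous_of_continuous_uncurry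
    exact (continuous_snd.add continuous_fst)
  have h0 := (continuous_const (y := hf.toLp f)).compMeasurePreservingLp hTc
    (μ := (volume : Measure Plane)) (ν := (volume : Measure Plane)) (fun y => hgm y) hp
  have h1 := (h0.tendsto 0).edist (tendsto_const_nhds (x := hf.toLp f))
  have e : ∀ y, edist (Lp.compMeasurePreserving (T y) (hgm y) (hf.toLp f)) (hf.toLp f) =
      eLpNorm (fun x => f (x + y) - f x) p := fun y => by
    rw [Lp.toLp_compMeasurePreserving, Lp.edist_toLp_toLp]
    rfl
  simp only [e] at h1
  simpa using h1

/-- Mollification with `ρ` of the correlation of `f` and `g` is the correlation of `f` with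
the mollified `g`. -/
theorem integral_mul_integral_translate_eq {f g ρ : Plane → ℝ} (hf : Integrable f)
    (hg : Integrable g) (hρ : Continuous ρ) {C : ℝ} (hC : ∀ x, ‖ρ x‖ ≤ C) :
    ∫ t, ρ t * ∫ x, g (x - t) * f x = ∫ x, f x * ∫ z, ρ (x - z) * g z := by
  have h1 : Integrable (fun p : Plane × Plane => f p.2 * g (-(p.1 - p.2)))
      (volume.prod volume) := by
    have := hf.convolution_integrand (ContinuousLinearMap.mul ℝ ℝ) hg.comp_neg
    simpa using this
  have h2 : Integrable (fun p : Plane × Plane => ρ p.1 * (f p.2 * g (-(p.1 - p.2))))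
      (volume.prod volume) :=
    h1.bdd_mul (c := C) (hρ.comp continuous_fst).aestronglyMeasurable (.of_forall fun p => hC _)
  calc ∫ t, ρ t * ∫ x, g (x - t) * f x
      = ∫ t, ∫ x, ρ t * (f x * g (-(t - x))) := by
        congr 1; ext t
        rw [← integral_const_mul]
        congr 1; ext x
        rw [neg_sub]; ring
    _ = ∫ x, ∫ t, ρ t * (f x * g (-(t - x))) := integral_integral_swap h2
    _ = ∫ x, f x * ∫ z, ρ (x - z) * g z := by
        congr 1; ext x
        rw [← integral_const_mul, ← integral_sub_left_eq_self _ _ x]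
        congr 1; ext z
        rw [show -(x - z - x) = z by abel]
        ring

theorem integrable_mul_mul_sub {f g ρ : Plane → ℝ} (hf : Integrable f)
    (hg : Integrable g) (hρ : Continuous ρ) {C : ℝ} (hC : ∀ x, ‖ρ x‖ ≤ C) :
    Integrable (fun p : Plane × Plane => f p.1 * (ρ (p.1 - p.2) * g p.2)) (volume.prod volume) := by
  have h := (hf.mul_prod hg).bdd_mul (c := C)
    (f := fun p : Plane × Plane => ρ (p.1 - p.2))
    (hρ.comp (continuous_fst.sub continuous_snd)).aestronglyMeasurable (.of_forall fun p => hC _)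
  refine h.congr (.of_forall fun p => ?_)
  simp only
  ring

theorem continuous_partialDeriv {η : Plane → ℝ} (hη : ContDiff ℝ ∞ η) (i : Fin 2) :
    Continuous (partialDeriv i η) :=
  (hη.continuous_fderiv (by simp)).clm_apply continuous_const

theorem partialDeriv_eq_zero_of_notMem_tsupport {η : Plane → ℝ} (i : Fin 2) {x : Plane}
    (hx : x ∉ tsupport η) : partialDeriv i η x = 0 := by
  have : x ∉ tsupport (fderiv ℝ η) := fun hx' => hx (tsupport_fderiv_subset ℝ hx')
  simp [partialDeriv, image_eq_zero_of_notMem_tsupport this]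

theorem exists_partialDeriv_bound {η : Plane → ℝ} (hη : ContDiff ℝ ∞ η) (hc : HasCompactSupport η)
    (i : Fin 2) : ∃ C, ∀ x, ‖partialDeriv i η x‖ ≤ C :=
  (hc.fderiv_apply ℝ (coordVec i)).exists_bound_of_continuous (continuous_partialDeriv hη i)

theorem LocallyIntegrableOn.integrable_mul_of_tsupport_subset {U : Set Plane} (hU : IsOpen U)
    {u : Plane → ℝ} (hu : LocallyIntegrableOn u U) {K : Set Plane} (hK : IsCompact K) (hKU : K ⊆ U)
    {ζ : Plane → ℝ} (hζ : Continuous ζ) (hb : ∃ C, ∀ x, ‖ζ x‖ ≤ C) (h0 : ∀ x, x ∉ K → ζ x = 0) :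
    Integrable (fun x => u x * ζ x) := by
  obtain ⟨C, hC⟩ := hb
  have h1 : IntegrableOn (fun x => u x * ζ x) K :=
    Integrable.mul_bdd (c := C) ((locallyIntegrableOn_iff hU.isLocallyClosed).1 hu K hKU hK)
      hζ.aestronglyMeasurable (.of_forall hC)
  rw [integrableOn_iff_integrable_of_support_subset] at h1
  · exact h1
  · intro x hx
    by_contra hxK
    exact hx (by simp [h0 x hxK])

/-- The product rule for weak derivatives. The second factor is bounded; the product of the first
factor with the derivative of the second is controlled by the duality hypothesis `hmul`, which says
that the first factor belongs locally to the dual of `L^δ`. -/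
theorem HasWeakPartialDeriv.mul {U : Set Plane} (hU : IsOpen U) (hUf : volume U ≠ ⊤)
    {u v gu gv : Plane → ℝ} {i : Fin 2} (hu : HasWeakPartialDeriv U i u gu)
    (hv : HasWeakPartialDeriv U i v gv) (hum : Measurable u) (hgum : Measurable gu)
    (hvm : Measurable v) (hgvm : Measurable gv) {M : ℝ} (hM : ∀ᵐ z, z ∈ U → ‖v z‖ ≤ M)
    {p : ℝ≥0∞} (hp1 : 1 ≤ p) (hp : p ≠ ⊤) (hgv : MemLp gv p (volume.restrict U))
    (hmul : ∀ K ⊆ U, IsCompact K → ∃ C : ℝ≥0∞, C ≠ ⊤ ∧ ∀ f : Plane → ℝ, Measurable f →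
      ∫⁻ z in K, ‖u z‖ₑ * ‖f z‖ₑ ≤ C * eLpNorm f p) :
    HasWeakPartialDeriv U i (fun z => u z * v z) (fun z => gu z * v z + u z * gv z) := by
  have hUm := hU.measurableSet
  have loc := fun (f : Plane → ℝ) => locallyIntegrableOn_iff (f := f) (μ := volume)
    (s := U) hU.isLocallyClosed
  -- the second factor and its derivative, extended by zero
  set V : Plane → ℝ := U.indicator v with hV
  set k : Plane → ℝ := U.indicator gv with hk
  have hVm : Measurable V := hvm.indicator hUm
  have hkm : Measurable k := hgvm.indicator hUm
  have hVM : ∀ᵐ z, ‖V z‖ ≤ max M 0 := by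
    filter_upwards [hM] with z hz
    by_cases h : z ∈ U
    · simp only [hV, indicator_of_mem h]; exact (hz h).trans (le_max_left _ _)
    · simp [hV, h]
  have hVi : Integrable V := by
    rw [hV, integrable_indicator_iff hUm]
    have : IsFiniteMeasure (volume.restrict U) := ⟨by simpa using hUf.lt_top⟩
    exact Integrable.of_bound hvm.aestronglyMeasurable M ((ae_restrict_iff' hUm).2 hM)
  have hkL : MemLp k p := (memLp_indicator_iff_restrict hUm).2 hgv
  have hki : Integrable k := by
    rw [hk, integrable_indicator_iff hUm]
    have : IsFiniteMeasure (volume.restrict U) := ⟨by simpa using hUf.lt_top⟩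
    exact hgv.integrable hp1
  have bdd : ∀ {f : Plane → ℝ}, LocallyIntegrableOn f U →
      LocallyIntegrableOn (fun z => f z * v z) U := by
    intro f hf
    rw [loc]
    intro K hK hKc
    refine ((loc f).1 hf K hK hKc).mul_bdd (c := M) hvm.aestronglyMeasurable ?_
    filter_upwards [ae_restrict_mem hKc.measurableSet, ae_restrict_of_ae hM] with z hz h
    exact h (hK hz)
  have prodInt : ∀ K ⊆ U, IsCompact K → IntegrableOn (fun z => u z * gv z) K := by
    intro K hK hKc
    obtain ⟨C, hC, h⟩ := hmul K hK hKc
    refine ⟨(hum.mul hgvm).aestronglyMeasurable, ?_⟩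
    refine lt_of_le_of_lt ?_ (ENNReal.mul_lt_top hC.lt_top hkL.2)
    refine le_trans (le_of_eq ?_) (h k hkm)
    refine setLIntegral_congr_fun hKc.measurableSet fun z hz => ?_
    simp only [hk, indicator_of_mem (hK hz), enorm_mul]
  have hloc2 : LocallyIntegrableOn (fun z => u z * gv z) U := (loc _).2 prodInt
  refine ⟨bdd hu.1, (bdd hu.2.1).add hloc2, fun η hη hηc hηU => ?_⟩
  have hηb := hηc.exists_bound_of_continuous hη.continuous
  have hηp := exists_partialDeriv_bound hη hηc i
  have hηpc := continuous_partialDeriv hη i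
  set K := tsupport η
  have hKc : IsCompact K := hηc
  have hη0 : ∀ x, x ∉ K → η x = 0 := fun x hx => image_eq_zero_of_notMem_tsupport hx
  have hηp0 : ∀ x, x ∉ K → partialDeriv i η x = 0 := fun x hx =>
    partialDeriv_eq_zero_of_notMem_tsupport i hx
  have iu := LocallyIntegrableOn.integrable_mul_of_tsupport_subset hU hu.1 hKc hηU hηpc hηp hηp0
  have igu := LocallyIntegrableOn.integrable_mul_of_tsupport_subset hU hu.2.1 hKc hηU
    hη.continuous hηb hη0
  set w : Plane → ℝ := fun x => u x * partialDeriv i η x + gu x * η x with hw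
  set s : Plane → ℝ := fun x => u x * η x with hs
  have hwi : Integrable w := iu.add igu
  have hsi : Integrable s := LocallyIntegrableOn.integrable_mul_of_tsupport_subset hU hu.1 hKc hηU
    hη.continuous hηb hη0
  have hwm : Measurable w := (hum.mul hηpc.measurable).add (hgum.mul hη.continuous.measurable)
  have hsm : Measurable s := hum.mul hη.continuous.measurable
  -- the identity to be proved is `G 0 = 0`
  set G₁ : Plane → ℝ := fun y => ∫ x, V (x + y) * w x with hG₁
  set G₂ : Plane → ℝ := fun y => ∫ x, k (x + y) * s x with hG₂
  obtain ⟨Cη, hCη⟩ := hηb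
  obtain ⟨C, hC, hCK⟩ := hmul K hηU hKc
  have hs_le : ∀ f : Plane → ℝ, Measurable f →
      ∫⁻ x, ‖f x * s x‖ₑ ≤ ENNReal.ofReal Cη * (C * eLpNorm f p) := by
    intro f hf
    calc ∫⁻ x, ‖f x * s x‖ₑ ≤ ∫⁻ x, K.indicator (fun x => ENNReal.ofReal Cη *
          (‖u x‖ₑ * ‖f x‖ₑ)) x := by
          refine lintegral_mono fun x => ?_
          by_cases hx : x ∈ K
          · simp only [indicator_of_mem hx, hs, enorm_mul]
            have : ‖η x‖ₑ ≤ ENNReal.ofReal Cη := by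
              rw [← ofReal_norm]; exact ENNReal.ofReal_le_ofReal (hCη x)
            calc ‖f x‖ₑ * (‖u x‖ₑ * ‖η x‖ₑ) = ‖η x‖ₑ * (‖u x‖ₑ * ‖f x‖ₑ) := by ring
              _ ≤ _ := by gcongr
          · simp [hs, hη0 x hx]
      _ = ENNReal.ofReal Cη * ∫⁻ x in K, ‖u x‖ₑ * ‖f x‖ₑ := by
          rw [lintegral_indicator hKc.measurableSet, lintegral_const_mul' _ _ ENNReal.ofReal_ne_top]
      _ ≤ _ := by gcongr; exact hCK f hf
  have hkL' : ∀ y, MemLp (fun x => k (x + y)) p := fun y =>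
    hkL.comp_measurePreserving (measurePreserving_add_right volume y)
  have iks : ∀ y, Integrable fun x => k (x + y) * s x := fun y => by
    have hm : Measurable fun x => k (x + y) := hkm.comp (by fun_prop)
    refine ⟨(hm.mul hsm).aestronglyMeasurable, (hs_le _ hm).trans_lt ?_⟩
    exact ENNReal.mul_lt_top ENNReal.ofReal_lt_top (ENNReal.mul_lt_top hC.lt_top (hkL' y).2)
  have lim₁ : Filter.Tendsto G₁ (nhds 0) (nhds (G₁ 0)) := by
    -- the translation is moved to the integrable factor
    have e : ∀ y, G₁ y = ∫ x, V x * w (x + -y) := fun y => by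
      rw [hG₁]
      simp only
      rw [← integral_add_right_eq_self (fun x => V x * w (x + -y)) y]
      simp
    have hw1 := (tendsto_eLpNorm_translate_sub (p := 1) le_rfl (by simp)
      (memLp_one_iff_integrable.2 hwi)).comp
      (show Filter.Tendsto (fun y : Plane => -y) (nhds 0) (nhds 0) by
        simpa using (continuous_neg.tendsto (0 : Plane)))
    have hw2 : Filter.Tendsto (fun y : Plane => ENNReal.ofReal (max M 0) *
        eLpNorm (fun x => w (x + -y) - w x) 1) (nhds 0) (nhds 0) := by
      simpa using ENNReal.Tendsto.const_mul hw1 (Or.inr ENNReal.ofReal_ne_top)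
    rw [tendsto_iff_edist_tendsto_0]
    refine tendsto_of_tendsto_of_tendsto_of_le_of_le tendsto_const_nhds hw2
      (fun _ => zero_le) fun y => ?_
    have i1 : Integrable fun x => V x * w (x + -y) :=
      (hwi.comp_add_right (-y)).bdd_mul (c := max M 0) hVm.aestronglyMeasurable hVM
    have i2 : Integrable fun x => V x * w x :=
      hwi.bdd_mul (c := max M 0) hVm.aestronglyMeasurable hVM
    have e0 : G₁ 0 = ∫ x, V x * w x := by simp [hG₁]
    simp only
    rw [e y, e0, edist_eq_enorm_sub, ← integral_sub i1 i2, eLpNorm_one_eq_lintegral_enorm,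
      ← lintegral_const_mul' _ _ ENNReal.ofReal_ne_top]
    refine (enorm_integral_le_lintegral_enorm _).trans (lintegral_mono_ae ?_)
    filter_upwards [hVM] with x hx
    rw [← mul_sub, enorm_mul]
    gcongr
    rw [← ofReal_norm]
    exact ENNReal.ofReal_le_ofReal hx
  have lim₂ : Filter.Tendsto G₂ (nhds 0) (nhds (G₂ 0)) := by
    have hk2 : Filter.Tendsto (fun y : Plane => ENNReal.ofReal Cη *
        (C * eLpNorm (fun x => k (x + y) - k x) p)) (nhds 0) (nhds 0) := by
      have := ENNReal.Tendsto.const_mul (ENNReal.Tendsto.const_mul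
        (tendsto_eLpNorm_translate_sub hp1 hp hkL) (Or.inr hC))
        (Or.inr (ENNReal.ofReal_ne_top (r := Cη)))
      simpa using this
    rw [tendsto_iff_edist_tendsto_0]
    refine tendsto_of_tendsto_of_tendsto_of_le_of_le tendsto_const_nhds hk2
      (fun _ => zero_le) fun y => ?_
    have e0 : G₂ 0 = ∫ x, k x * s x := by simp [hG₂]
    have i0 : Integrable fun x => k x * s x := by simpa using iks 0
    simp only
    rw [e0, edist_eq_enorm_sub, ← integral_sub (iks y) i0]
    refine (enorm_integral_le_lintegral_enorm _).trans ?_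
    simp_rw [← sub_mul]
    exact hs_le _ ((hkm.comp (by fun_prop)).sub hkm)
  -- averages of `G₁ + G₂` over small balls vanish
  have mollified : ∀ᶠ r in nhdsWithin (0 : ℝ) (Ioi 0), ∀ ρ : Plane → ℝ, ContDiff ℝ ∞ ρ →
      HasCompactSupport ρ → tsupport ρ ⊆ Metric.closedBall 0 r →
      ∫ t, ρ t * (G₁ (-t) + G₂ (-t)) = 0 := by
    obtain ⟨r₀, hr₀, hthick⟩ := hKc.exists_cthickening_subset_open hU hηU
    filter_upwards [Ioo_mem_nhdsGT hr₀] with r hr ρ hρ hρc hρr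
    obtain ⟨Cρ, hCρ⟩ := hρc.exists_bound_of_continuous hρ.continuous
    obtain ⟨Cρ', hCρ'⟩ := exists_partialDeriv_bound hρ hρc i
    have hρpc := continuous_partialDeriv hρ i
    -- the weak derivative of `v` is tested against the reflected translate of `ρ`
    have hder : ∀ x, s x * ∫ z, ρ (x - z) * k z =
        s x * ∫ z, partialDeriv i ρ (x - z) * V z := by
      intro x
      by_cases hx : x ∈ K
      swap
      · simp [hs, hη0 x hx]
      congr 1
      set ζ : Plane → ℝ := fun z => ρ (x - z) with hζ
      have hζd : ContDiff ℝ ∞ ζ := hρ.comp (contDiff_const.sub contDiff_id)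
      have hζs : tsupport ζ ⊆ Metric.closedBall x r := by
        intro z hz
        have : x - z ∈ tsupport ρ :=
          tsupport_comp_subset_preimage ρ (f := fun z : Plane => x - z) (by fun_prop) hz
        have := hρr this
        rw [mem_closedBall_zero_iff] at this
        rwa [Metric.mem_closedBall, dist_comm, dist_eq_norm]
      have hζU : tsupport ζ ⊆ U := hζs.trans
        ((Metric.closedBall_subset_closedBall hr.2.le).trans
          ((Metric.closedBall_subset_cthickening hx r₀).trans hthick))
      have hζc : HasCompactSupport ζ := HasCompactSupport.of_support_subset_isCompact
        (isCompact_closedBall x r) ((subset_tsupport ζ).trans hζs)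
      have hζp : ∀ z, partialDeriv i ζ z = - partialDeriv i ρ (x - z) := fun z => by
        simp only [partialDeriv, hζ]
        have h1 := (hρ.differentiable (by simp) (x - z)).hasFDerivAt.comp z
          ((hasFDerivAt_id z).const_sub x)
        rw [HasFDerivAt.fderiv (f := fun z => ρ (x - z)) h1]
        simp
      have h1 := hv.2.2 ζ hζd hζc hζU
      rw [← integral_indicator hUm, ← integral_indicator hUm] at h1
      have e1 : ∫ z, ρ (x - z) * k z = ∫ z, U.indicator (fun z => gv z * ζ z) z := by
        congr 1; ext z
        by_cases h : z ∈ U <;> simp [hk, hζ, h, mul_comm]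
      have e2 : ∫ z, partialDeriv i ρ (x - z) * V z =
          - ∫ z, U.indicator (fun z => v z * partialDeriv i ζ z) z := by
        rw [← integral_neg]
        congr 1; ext z
        by_cases h : z ∈ U <;> simp [hV, h, hζp, mul_comm]
      rw [e1, e2, h1, neg_neg]
    -- the first factor is tested against `η` times a translate of `ρ`
    have htest : ∀ z, ∫ x, (w x * ρ (x - z) + s x * partialDeriv i ρ (x - z)) = 0 := by
      intro z
      set ζ : Plane → ℝ := fun x => η x * ρ (x - z) with hζ
      have hρz : ContDiff ℝ ∞ fun x : Plane => ρ (x - z) := hρ.comp (contDiff_id.sub contDiff_const)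
      have hζd : ContDiff ℝ ∞ ζ := hη.mul hρz
      have hζs : tsupport ζ ⊆ K := closure_mono fun x hx => by
        intro h0; exact hx (by simp [hζ, h0])
      have hζc : HasCompactSupport ζ := HasCompactSupport.of_support_subset_isCompact hKc
        ((subset_tsupport ζ).trans hζs)
      have hζp : ∀ x, partialDeriv i ζ x =
          partialDeriv i η x * ρ (x - z) + η x * partialDeriv i ρ (x - z) := fun x => by
        simp only [partialDeriv, hζ]
        rw [fderiv_fun_mul (hη.differentiable (by simp) x) (hρz.differentiable (by simp) x),
          fderiv_comp_sub]
        simp only [_root_.add_apply, _root_.smul_apply, smul_eq_mul]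
        ring
      have h1 := hu.2.2 ζ hζd hζc (hζs.trans hηU)
      have hz0 : ∀ x, x ∉ K → ζ x = 0 := fun x hx => by simp [hζ, hη0 x hx]
      have hp0 : ∀ x, x ∉ K → partialDeriv i ζ x = 0 := fun x hx => by
        rw [hζp, hηp0 x hx, hη0 x hx]; ring
      rw [setIntegral_eq_integral_of_forall_compl_eq_zero (fun x hx => by
          rw [hp0 x fun h => hx (hηU h), mul_zero]),
        setIntegral_eq_integral_of_forall_compl_eq_zero (fun x hx => by
          rw [hz0 x fun h => hx (hηU h), mul_zero])] at h1
      have i1 := LocallyIntegrableOn.integrable_mul_of_tsupport_subset hU hu.1 hKc hηU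
        (continuous_partialDeriv hζd i) (exists_partialDeriv_bound hζd hζc i) hp0
      have i2 := LocallyIntegrableOn.integrable_mul_of_tsupport_subset hU hu.2.1 hKc hηU
        hζd.continuous (hζc.exists_bound_of_continuous hζd.continuous) hz0
      calc _ = ∫ x, (u x * partialDeriv i ζ x + gu x * ζ x) := by
            congr 1; ext x
            rw [hζp]; simp only [hw, hs, hζ]; ring
        _ = 0 := by rw [integral_add i1 i2, h1]; ring
    have f1 := integrable_mul_mul_sub hwi hVi hρ.continuous hCρ
    have f2 := integrable_mul_mul_sub hsi hVi hρpc hCρ'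
    have hI : ∀ {f g : Plane → ℝ}, Integrable f → Integrable g →
        Integrable fun t => ρ t * ∫ x, g (x - t) * f x := by
      intro f g hf hg
      have h1 : Integrable (fun p : Plane × Plane => f p.2 * g (-(p.1 - p.2)))
          (volume.prod volume) := by
        simpa using hf.convolution_integrand (ContinuousLinearMap.mul ℝ ℝ) hg.comp_neg
      refine (h1.integral_prod_left.bdd_mul (c := Cρ) hρ.continuous.aestronglyMeasurable
        (.of_forall hCρ)).congr (.of_forall fun t => ?_)
      simp only [neg_sub, mul_comm]
    have e1 : ∀ t, G₁ (-t) = ∫ x, V (x - t) * w x := fun t => by simp only [hG₁, sub_eq_add_neg]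
    have e2 : ∀ t, G₂ (-t) = ∫ x, k (x - t) * s x := fun t => by simp only [hG₂, sub_eq_add_neg]
    simp only [e1, e2, mul_add]
    rw [integral_add (hI hwi hVi) (hI hsi hki),
      integral_mul_integral_translate_eq hwi hVi hρ.continuous hCρ,
      integral_mul_integral_translate_eq hsi hki hρ.continuous hCρ]
    simp_rw [hder, ← integral_const_mul]
    rw [integral_integral_swap (f := fun x z => w x * (ρ (x - z) * V z)) f1,
      integral_integral_swap (f := fun x z => s x * (partialDeriv i ρ (x - z) * V z)) f2,
      ← integral_add f1.integral_prod_right f2.integral_prod_right]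
    refine integral_eq_zero_of_ae (.of_forall fun z => ?_)
    have i1 : Integrable fun x => w x * ρ (x - z) := hwi.mul_bdd (c := Cρ)
      (hρ.continuous.comp (by fun_prop)).aestronglyMeasurable (.of_forall fun x => hCρ _)
    have i2 : Integrable fun x => s x * partialDeriv i ρ (x - z) := hsi.mul_bdd (c := Cρ')
      (hρpc.comp (by fun_prop)).aestronglyMeasurable (.of_forall fun x => hCρ' _)
    have h1 := htest z
    rw [integral_add i1 i2] at h1
    simp only [← mul_assoc, integral_mul_const, ← add_mul, h1, zero_mul, Pi.zero_apply]
  have hGm : Measurable fun y => G₁ y + G₂ y := by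
    refine Measurable.add ?_ ?_
    · exact (StronglyMeasurable.integral_prod_right'
        (f := fun q : Plane × Plane => V (q.2 + q.1) * w q.2)
        ((hVm.comp (by fun_prop)).mul (hwm.comp (by fun_prop))).stronglyMeasurable).measurable
    · exact (StronglyMeasurable.integral_prod_right'
        (f := fun q : Plane × Plane => k (q.2 + q.1) * s q.2)
        ((hkm.comp (by fun_prop)).mul (hsm.comp (by fun_prop))).stronglyMeasurable).measurable
  have hG0 : G₁ 0 + G₂ 0 = 0 := by
    set φ : ℕ → ContDiffBump (0 : Plane) := fun n =>
      ⟨1 / ((n : ℝ) + 1) / 2, 1 / ((n : ℝ) + 1), by positivity, half_lt_self (by positivity)⟩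
    have hlim : Filter.Tendsto (fun n => (φ n).rOut) Filter.atTop (nhds 0) :=
      tendsto_one_div_add_atTop_nhds_zero_nat
    have h1 := ContDiffBump.convolution_tendsto_right (μ := volume) (φ := φ)
      (g := fun _ => fun y => G₁ y + G₂ y) (k := fun _ => 0) hlim
      (.of_forall fun _ => hGm.aestronglyMeasurable)
      ((lim₁.add lim₂).comp Filter.tendsto_snd) tendsto_const_nhds
    have h2 : Filter.Tendsto (fun n => (φ n).rOut) Filter.atTop (nhdsWithin 0 (Ioi 0)) :=
      tendsto_nhdsWithin_iff.2 ⟨hlim, .of_forall fun n => (φ n).rOut_pos⟩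
    refine tendsto_nhds_unique h1 (tendsto_const_nhds.congr' ?_)
    filter_upwards [h2.eventually mollified] with n hn
    have h3 := hn ((φ n).normed volume) (φ n).contDiff_normed (φ n).hasCompactSupport_normed
      (φ n).tsupport_normed_eq.subset
    rw [convolution_def, ← h3]
    simp
  have t1 : G₁ 0 = ∫ z in U, u z * v z * partialDeriv i η z + gu z * v z * η z := by
    rw [← integral_indicator hUm]
    simp only [hG₁]
    congr 1; ext z
    by_cases h : z ∈ U
    · simp only [add_zero, hV, hw, indicator_of_mem h]; ring
    · simp [hV, h]
  have t2 : G₂ 0 = ∫ z in U, u z * gv z * η z := by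
    rw [← integral_indicator hUm]
    simp only [hG₂]
    congr 1; ext z
    by_cases h : z ∈ U
    · simp only [add_zero, hk, hs, indicator_of_mem h]; ring
    · simp [hk, h]
  have j1 := (LocallyIntegrableOn.integrable_mul_of_tsupport_subset hU (bdd hu.1) hKc hηU hηpc hηp
    hηp0).integrableOn (s := U)
  have j2 := (LocallyIntegrableOn.integrable_mul_of_tsupport_subset hU (bdd hu.2.1) hKc hηU
    hη.continuous ⟨Cη, hCη⟩ hη0).integrableOn (s := U)
  have j3 := (LocallyIntegrableOn.integrable_mul_of_tsupport_subset hU hloc2 hKc hηU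
    hη.continuous ⟨Cη, hCη⟩ hη0).integrableOn (s := U)
  rw [t1, t2, integral_add j1 j2] at hG0
  simp_rw [add_mul]
  rw [integral_add j2 j3]
  linarith

/-! ### The weighted Sobolev space and its global weight -/

theorem HasWeakPartialDeriv.mono {U S : Set Plane} (hSU : S ⊆ U) {i : Fin 2}
    {f g : Plane → ℝ} (h : HasWeakPartialDeriv U i f g) : HasWeakPartialDeriv S i f g := by
  refine ⟨h.1.mono_set hSU, h.2.1.mono_set hSU, fun η hη hηc hηS => ?_⟩
  have key := h.2.2 η hη hηc (hηS.trans hSU)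
  have e : ∀ (a b : Plane → ℝ), (∀ z, z ∉ tsupport η → b z = 0) →
      ∫ z in U, a z * b z = ∫ z in S, a z * b z := by
    intro a b hb
    rw [setIntegral_eq_integral_of_forall_compl_eq_zero fun z hz => by
        rw [hb z fun h => hz (hSU (hηS h)), mul_zero],
      setIntegral_eq_integral_of_forall_compl_eq_zero fun z hz => by
        rw [hb z fun h => hz (hηS h), mul_zero]]
  rwa [e _ _ fun z hz => partialDeriv_eq_zero_of_notMem_tsupport i hz,
    e _ _ fun z hz => image_eq_zero_of_notMem_tsupport hz] at key

theorem HasWeakPartialDeriv.congr {U : Set Plane} {i : Fin 2}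
    {f g f' g' : Plane → ℝ} (h : HasWeakPartialDeriv U i f g)
    (hf : f =ᵐ[volume.restrict U] f') (hg : g =ᵐ[volume.restrict U] g') :
    HasWeakPartialDeriv U i f' g' := by
  refine ⟨LocallyIntegrableOn.congr hf h.1, LocallyIntegrableOn.congr hg h.2.1, fun η hη hηc hηU => ?_⟩
  have e1 : ∫ z in U, f' z * partialDeriv i η z = ∫ z in U, f z * partialDeriv i η z :=
    integral_congr_ae (hf.symm.mul (ae_eq_refl _))
  have e2 : ∫ z in U, g' z * η z = ∫ z in U, g z * η z :=
    integral_congr_ae (hg.symm.mul (ae_eq_refl _))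
  rw [e1, e2, h.2.2 η hη hηc hηU]

theorem memLp_ofReal_iff_lintegral {s : Set Plane} {q : ℝ} (hq : 0 < q) {f : Plane → ℝ}
    (hf : AEStronglyMeasurable f (volume.restrict s)) :
    MemLp f (ENNReal.ofReal q) (volume.restrict s) ↔ ∫⁻ z in s, ‖f z‖ₑ ^ q ≠ ⊤ := by
  have h := eLpNorm_lt_top_iff_lintegral_rpow_enorm_lt_top (μ := volume.restrict s) (f := f)
    (p := ENNReal.ofReal q) (by simpa using hq) ENNReal.ofReal_ne_top
  rw [ENNReal.toReal_ofReal hq.le, lt_top_iff_ne_top (a := ∫⁻ z in s, ‖f z‖ₑ ^ q)] at h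
  exact ⟨fun hm => h.1 hm.2, fun hm => ⟨hf, h.2 hm⟩⟩

theorem memLp_iUnion {ι : Type*} [Finite ι] {s : ι → Set Plane} {q : ℝ} (hq : 0 < q)
    {f : Plane → ℝ} (h : ∀ i, MemLp f (ENNReal.ofReal q) (volume.restrict (s i))) :
    MemLp f (ENNReal.ofReal q) (volume.restrict (⋃ i, s i)) := by
  have := Fintype.ofFinite ι
  have hm : AEStronglyMeasurable f (volume.restrict (⋃ i, s i)) :=
    aestronglyMeasurable_iUnion_iff.2 fun i => (h i).1
  rw [memLp_ofReal_iff_lintegral hq hm]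
  refine ne_top_of_le_ne_top ?_ (lintegral_iUnion_le s _)
  rw [tsum_fintype]
  exact ENNReal.sum_ne_top.2 fun i _ => (memLp_ofReal_iff_lintegral hq (h i).1).1 (h i)

theorem memLp_union {s t : Set Plane} {q : ℝ} (hq : 0 < q)
    {f : Plane → ℝ} (hs : MemLp f (ENNReal.ofReal q) (volume.restrict s))
    (ht : MemLp f (ENNReal.ofReal q) (volume.restrict t)) :
    MemLp f (ENNReal.ofReal q) (volume.restrict (s ∪ t)) := by
  rw [union_eq_iUnion]
  exact memLp_iUnion hq fun b => by cases b <;> assumption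

theorem exists_cornerWeight_le_awayFromCorners {m : ℕ} {Ω : Set Plane} {x : Fin m → Plane}
    {R β : Fin m → ℝ} (hΩ : Bornology.IsBounded Ω) (hR : AdmissibleRadii x R) (hβ : ∀ j, 0 ≤ β j) :
    ∃ C : ℝ, ∀ z ∈ awayFromCorners Ω x R, cornerWeight x β z ≤ C ∧ 1 ≤ C * cornerWeight x β z := by
  obtain ⟨B, hB⟩ := hΩ.isCompact_closure.exists_bound_of_continuousOn
    (continuous_cornerWeight x hβ).continuousOn
  set c := ∏ j, (R j / 2) ^ β j
  have hc0 : 0 < c := Finset.prod_pos fun j _ => Real.rpow_pos_of_pos (by linarith [(hR j).1]) _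
  refine ⟨max B c⁻¹, fun z hz => ⟨?_, ?_⟩⟩
  · exact (le_abs_self _).trans ((hB z (subset_closure hz.1)).trans (le_max_left _ _))
  · have h1 : c ≤ cornerWeight x β z := by
      refine Finset.prod_le_prod (fun j _ => Real.rpow_nonneg (by linarith [(hR j).1]) _)
        fun j _ => Real.rpow_le_rpow (by linarith [(hR j).1]) ?_ (hβ j)
      by_contra hlt
      exact hz.2 (mem_iUnion.2 ⟨j, hz.1, Metric.mem_ball.2 (not_le.1 hlt)⟩)
    calc 1 = c⁻¹ * c := (inv_mul_cancel₀ hc0.ne').symm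
      _ ≤ max B c⁻¹ * cornerWeight x β z := by
        gcongr
        exact le_max_right _ _

theorem exists_cornerWeight_le_cornerNhd {m : ℕ} {Ω : Set Plane} {x : Fin m → Plane}
    {R β : Fin m → ℝ} (hΩ : Bornology.IsBounded Ω) (hR : AdmissibleRadii x R) (hβ : ∀ j, 0 ≤ β j)
    (j : Fin m) : ∃ C : ℝ, ∀ z ∈ cornerNhd Ω x R j,
      cornerWeight x β z ≤ C * dist z (x j) ^ β j ∧ dist z (x j) ^ β j ≤ C * cornerWeight x β z := by
  obtain ⟨B, hB⟩ := hΩ.isCompact_closure.exists_bound_of_continuousOn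
    (continuous_prod_dist_rpow x hβ (Finset.univ.erase j)).continuousOn
  have hd : ∀ i ∈ Finset.univ.erase j, 0 < dist (x i) (x j) - R j := fun i hi =>
    sub_pos.2 ((hR j).2.2 i (Finset.ne_of_mem_erase hi))
  set c := ∏ i ∈ Finset.univ.erase j, (dist (x i) (x j) - R j) ^ β i
  have hc0 : 0 < c := Finset.prod_pos fun i hi => Real.rpow_pos_of_pos (hd i hi) _
  refine ⟨max B c⁻¹, fun z hz => ?_⟩
  have e : cornerWeight x β z =
      dist z (x j) ^ β j * ∏ i ∈ Finset.univ.erase j, dist z (x i) ^ β i :=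
    (Finset.mul_prod_erase _ (fun j => dist z (x j) ^ β j) (Finset.mem_univ j)).symm
  have hr : 0 ≤ dist z (x j) ^ β j := Real.rpow_nonneg dist_nonneg _
  constructor
  · rw [e, mul_comm]
    gcongr
    exact (le_abs_self _).trans ((hB z (subset_closure hz.1)).trans (le_max_left _ _))
  · have h1 : c ≤ ∏ i ∈ Finset.univ.erase j, dist z (x i) ^ β i := by
      refine Finset.prod_le_prod (fun i hi => Real.rpow_nonneg (hd i hi).le _)
        fun i hi => Real.rpow_le_rpow (hd i hi).le ?_ (hβ i)
      have := Metric.mem_ball.1 hz.2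
      linarith [dist_triangle_left (x i) (x j) z]
    calc dist z (x j) ^ β j = c⁻¹ * (dist z (x j) ^ β j * c) := by field_simp
      _ ≤ max B c⁻¹ * (dist z (x j) ^ β j * ∏ i ∈ Finset.univ.erase j, dist z (x i) ^ β i) := by
        gcongr
        exact le_max_right _ _
      _ = _ := by rw [e]

/-- The local weighted norms can be replaced by one global norm with the weight `cornerWeight`. -/
theorem memLp_cornerWeight_mul_iff {m : ℕ} {Ω : Set Plane} {x : Fin m → Plane}
    {R β : Fin m → ℝ} (hΩo : IsOpen Ω) (hΩ : Bornology.IsBounded Ω) (hR : AdmissibleRadii x R)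
    (hβ : ∀ j, 0 ≤ β j) {q : ℝ} (hq : 0 < q) {v : Plane → ℝ}
    (hv : AEStronglyMeasurable v (volume.restrict Ω)) :
    MemLp (fun z => cornerWeight x β z * v z) (ENNReal.ofReal q) (volume.restrict Ω) ↔
      MemLp v (ENNReal.ofReal q) (volume.restrict (awayFromCorners Ω x R)) ∧
      ∀ j, MemLp (fun z => dist z (x j) ^ β j * v z) (ENNReal.ofReal q)
        (volume.restrict (cornerNhd Ω x R j)) := by
  have hcm : ∀ R : Fin m → ℝ, ∀ j, MeasurableSet (cornerNhd Ω x R j) := fun R j =>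
    hΩo.measurableSet.inter Metric.isOpen_ball.measurableSet
  have ham : MeasurableSet (awayFromCorners Ω x R) :=
    hΩo.measurableSet.diff (MeasurableSet.iUnion fun j => hcm _ j)
  have haΩ : awayFromCorners Ω x R ⊆ Ω := sdiff_subset
  have hcΩ : ∀ j, cornerNhd Ω x R j ⊆ Ω := fun j => inter_subset_left
  have hWv : AEStronglyMeasurable (fun z => cornerWeight x β z * v z) (volume.restrict Ω) :=
    (continuous_cornerWeight x hβ).aestronglyMeasurable.mul hv
  have hdv : ∀ j, AEStronglyMeasurable (fun z => dist z (x j) ^ β j * v z)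
      (volume.restrict Ω) := fun j =>
    ((continuous_id.dist continuous_const).rpow_const fun _ =>
      Or.inr (hβ j)).aestronglyMeasurable.mul hv
  have hres : ∀ {s : Set Plane} {f : Plane → ℝ}, s ⊆ Ω →
      AEStronglyMeasurable f (volume.restrict Ω) → AEStronglyMeasurable f (volume.restrict s) :=
    fun hs hf => hf.mono_measure (Measure.restrict_mono hs le_rfl)
  obtain ⟨C, hC⟩ := exists_cornerWeight_le_awayFromCorners hΩ hR hβ
  choose C' hC' using exists_cornerWeight_le_cornerNhd hΩ hR hβ
  have hW0 := cornerWeight_nonneg x β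
  have hr0 : ∀ z j, 0 ≤ dist z (x j) ^ β j := fun z j => Real.rpow_nonneg dist_nonneg _
  constructor
  · intro h
    refine ⟨?_, fun j => ?_⟩
    · refine (h.mono_measure (Measure.restrict_mono haΩ le_rfl)).of_le_mul (c := C) (hres haΩ hv) ?_
      filter_upwards [ae_restrict_mem ham] with z hz
      rw [norm_mul, Real.norm_of_nonneg (hW0 z), ← mul_assoc]
      exact le_mul_of_one_le_left (norm_nonneg _) (hC z hz).2
    · refine (h.mono_measure (Measure.restrict_mono (hcΩ j) le_rfl)).of_le_mul (c := C' j)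
        (hres (hcΩ j) (hdv j)) ?_
      filter_upwards [ae_restrict_mem (hcm R j)] with z hz
      rw [norm_mul, norm_mul, Real.norm_of_nonneg (hW0 z), Real.norm_of_nonneg (hr0 z j),
        ← mul_assoc]
      gcongr
      exact (hC' j z hz).2
  · rintro ⟨h1, h2⟩
    have cover : Ω ⊆ awayFromCorners Ω x R ∪ ⋃ j, cornerNhd Ω x R j := by
      intro z hz
      by_cases h : z ∈ ⋃ j, cornerNhd Ω x R j
      · exact Or.inr h
      · refine Or.inl ⟨hz, fun h' => h ?_⟩
        obtain ⟨j, hj⟩ := mem_iUnion.1 h'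
        exact mem_iUnion.2 ⟨j, hj.1, Metric.ball_subset_ball (by linarith [(hR j).1]) hj.2⟩
    refine MemLp.mono_measure (Measure.restrict_mono cover le_rfl)
      (memLp_union hq ?_ (memLp_iUnion hq fun j => ?_))
    · refine h1.of_le_mul (c := C) (hres haΩ hWv) ?_
      filter_upwards [ae_restrict_mem ham] with z hz
      rw [norm_mul, Real.norm_of_nonneg (hW0 z)]
      gcongr
      exact (hC z hz).1
    · refine (h2 j).of_le_mul (c := C' j) (hres (hcΩ j) hWv) ?_
      filter_upwards [ae_restrict_mem (hcm R j)] with z hz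
      rw [norm_mul, norm_mul, Real.norm_of_nonneg (hW0 z), Real.norm_of_nonneg (hr0 z j),
        ← mul_assoc]
      gcongr
      exact (hC' j z hz).1

theorem memWeightedSobolev_iff {m : ℕ} {Ω : Set Plane} {x : Fin m → Plane}
    {R β : Fin m → ℝ} (hΩo : IsOpen Ω) (hΩ : Bornology.IsBounded Ω) (hR : AdmissibleRadii x R)
    (hβ : ∀ j, 0 ≤ β j) {q : ℝ} (hq : 0 < q) {v : Plane → ℝ} :
    MemWeightedSobolev Ω x R β (ENNReal.ofReal q) v ↔
      ∃ g : Fin 2 → Plane → ℝ, (∀ i, HasWeakPartialDeriv Ω i v (g i)) ∧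
        MemLp (fun z => cornerWeight x β z * v z) (ENNReal.ofReal q) (volume.restrict Ω) ∧
        ∀ i, MemLp (fun z => cornerWeight x β z * g i z) (ENNReal.ofReal q)
          (volume.restrict Ω) := by
  refine exists_congr fun g => and_congr_right fun hw => ?_
  rw [memLp_cornerWeight_mul_iff hΩo hΩ hR hβ hq (hw 0).1.aestronglyMeasurable]
  simp only [fun i => memLp_cornerWeight_mul_iff hΩo hΩ hR hβ hq (hw i).2.1.aestronglyMeasurable]
  exact ⟨fun ⟨h1, h2, h3⟩ => ⟨⟨h1, fun j => (h3 j).1⟩, fun i => ⟨h2 i, fun j => (h3 j).2 i⟩⟩,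
    fun ⟨h1, h2⟩ => ⟨h1.1, fun i => (h2 i).1, fun j => ⟨h1.2 j, fun i => (h2 i).2 j⟩⟩⟩

/-! ### Embeddings on a polygonal domain -/

theorem lintegral_gradNorm_rpow_ne_top {s : Set Plane} {q : ℝ} (hq : 0 < q) {W : Plane → ℝ}
    {g : Fin 2 → Plane → ℝ}
    (h : ∀ i, MemLp (fun z => W z * g i z) (ENNReal.ofReal q) (volume.restrict s)) :
    ∫⁻ z in s, (‖W z‖ₑ * gradNorm g z) ^ q ≠ ⊤ := by
  have h1 := (h 0).norm.add (h 1).norm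
  have h2 := (memLp_ofReal_iff_lintegral hq h1.1).1 h1
  refine ne_top_of_le_ne_top h2 (le_of_eq (lintegral_congr fun z => ?_))
  congr 1
  simp only [Pi.add_apply, gradNorm, Fin.sum_univ_two, mul_add, ← enorm_mul]
  rw [Real.enorm_of_nonneg
      (add_nonneg (norm_nonneg (W z * g 0 z)) (norm_nonneg (W z * g 1 z))),
    ENNReal.ofReal_add (norm_nonneg _) (norm_nonneg _), ofReal_norm, ofReal_norm]

theorem exists_bounds_of_subset_ball {S : Set Plane} (hSo : IsOpen S) (hSn : S.Nonempty) {p : Plane}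
    {ε : ℝ} (hSb : S ⊆ Metric.ball p ε) :
    ∃ (A : Set Plane) (D : ℝ), A ⊆ S ∧ IsCompact A ∧ A.Nonempty ∧ volume A ≠ 0 ∧ 0 < D ∧
      (∀ x ∈ S, ∀ y ∈ S, dist y x ≤ D) ∧ volume S ≠ ⊤ := by
  obtain ⟨c, hc⟩ := hSn
  obtain ⟨ρ, hρ, hρS⟩ := Metric.nhds_basis_closedBall.mem_iff.1 (hSo.mem_nhds hc)
  have hε : 0 < ε := dist_nonneg.trans_lt (Metric.mem_ball.1 (hSb hc))
  refine ⟨Metric.closedBall c ρ, 2 * ε, hρS, isCompact_closedBall _ _,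
    ⟨c, Metric.mem_closedBall_self hρ.le⟩, (Metric.measure_closedBall_pos _ _ hρ).ne',
    by positivity, fun x hx y hy => ?_, ((measure_mono hSb).trans_lt measure_ball_lt_top).ne⟩
  have h1 := Metric.mem_ball.1 (hSb hx)
  have h2 := Metric.mem_ball.1 (hSb hy)
  linarith [dist_triangle_right y x p]

/-- Functions in `W^{1,δ}`, `δ > 2`, are bounded on a polygonal domain. -/
theorem IsPolygonalDomain.exists_ae_enorm_le {m : ℕ} [NeZero m] {Ω : Set Plane}
    {x : Fin m → Plane} {om : Fin m → ℝ} (hΩ : IsPolygonalDomain Ω x om) {v : Plane → ℝ}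
    {g : Fin 2 → Plane → ℝ} (hvm : Measurable v) (hgm : ∀ i, Measurable (g i))
    (hw : ∀ i, HasWeakPartialDeriv Ω i v (g i)) {δ : ℝ} (hδ : 2 < δ)
    (hg : ∀ i, MemLp (g i) (ENNReal.ofReal δ) (volume.restrict Ω)) :
    ∃ M : ℝ≥0∞, M ≠ ⊤ ∧ ∀ᵐ z, z ∈ Ω → ‖v z‖ₑ ≤ M := by
  obtain ⟨F, hF, hFS, h0⟩ := hΩ.exists_finite_convex_cover (ε := fun _ => 1) fun _ => one_pos
  have hgΩ : ∫⁻ z in Ω, gradNorm g z ^ δ ≠ ⊤ := by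
    simpa using lintegral_gradNorm_rpow_ne_top (s := Ω) (W := fun _ => 1) (by linarith : 0 < δ)
      (by simpa using hg)
  have hex : ∀ S : F, ∃ M : ℝ≥0∞, M ≠ ⊤ ∧ ∀ᵐ z, z ∈ (S : Set Plane) → ‖v z‖ₑ ≤ M := by
    rintro ⟨S, hS⟩
    obtain ⟨hSo, hSc, hSn, hSΩ, p, hSb⟩ := hFS S hS
    obtain ⟨A, D, -, -, -, -, hD, hdiam, -⟩ := exists_bounds_of_subset_ball hSo hSn hSb
    exact exists_enorm_le_of_convex hSo hSc hSn hD hdiam hvm hgm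
      (fun i => (hw i).mono hSΩ) hδ (ne_top_of_le_ne_top hgΩ (lintegral_mono_set hSΩ))
  choose M hM hMv using hex
  have := hF.fintype
  refine ⟨∑ S : F, M S, ENNReal.sum_ne_top.2 fun S _ => hM S, ?_⟩
  have h1 : ∀ᵐ z, z ∉ Ω \ ⋃₀ F := measure_eq_zero_iff_ae_notMem.1 h0
  filter_upwards [h1, ae_all_iff.2 hMv] with z hz h hzΩ
  have hzF : z ∈ ⋃₀ F := by
    by_contra hn
    exact hz ⟨hzΩ, hn⟩
  obtain ⟨S, hS, hzS⟩ := hzF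
  exact (h ⟨S, hS⟩ hzS).trans
    (Finset.single_le_sum (f := M) (fun _ _ => zero_le) (Finset.mem_univ (⟨S, hS⟩ : F)))

/-- The weighted Sobolev inequality on a polygonal domain, in the dual form of a bound
for products with functions in `L^δ`, `δ > max 2 q`. -/
theorem IsPolygonalDomain.exists_lintegral_mul_cornerWeight_rpow_le {m : ℕ} [NeZero m]
    {Ω : Set Plane} {x : Fin m → Plane} {om : Fin m → ℝ} (hΩ : IsPolygonalDomain Ω x om)
    {β : Fin m → ℝ} (hβ : ∀ j, 0 ≤ β j) {u : Plane → ℝ} {g : Fin 2 → Plane → ℝ}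
    (hum : Measurable u) (hgm : ∀ i, Measurable (g i))
    (hw : ∀ i, HasWeakPartialDeriv Ω i u (g i)) {q δ : ℝ} (hq : 1 < q) (hδ : 2 < δ) (hqδ : q < δ)
    (hg : ∀ i, MemLp (fun z => cornerWeight x β z * g i z) (ENNReal.ofReal q)
      (volume.restrict Ω)) :
    ∃ M : ℝ≥0∞, M ≠ ⊤ ∧ ∀ H : Plane → ℝ≥0∞, Measurable H →
      ∫⁻ z in Ω, (H z * (‖cornerWeight x β z‖ₑ * ‖u z‖ₑ)) ^ q ≤
        M * (∫⁻ z in Ω, H z ^ δ) ^ (q / δ) := by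
  have hq0 : 0 < q := by linarith
  choose ε hε hseg using exists_cornerWeight_segment hΩ.vertex_injective hβ
  obtain ⟨F, hF, hFS, h0⟩ := hΩ.exists_finite_convex_cover hε
  obtain ⟨B, hB⟩ := hΩ.isBounded.isCompact_closure.exists_bound_of_continuousOn
    (continuous_cornerWeight x hβ).continuousOn
  have hgΩ := lintegral_gradNorm_rpow_ne_top hq0 hg
  have hWm : Measurable fun z => ‖cornerWeight x β z‖ₑ :=
    (continuous_cornerWeight x hβ).measurable.enorm
  have hex : ∀ S : F, ∃ M : ℝ≥0∞, M ≠ ⊤ ∧ ∀ H : Plane → ℝ≥0∞, Measurable H →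
      ∫⁻ z in (S : Set Plane), (H z * (‖cornerWeight x β z‖ₑ * ‖u z‖ₑ)) ^ q ≤
        M * (∫⁻ z in (S : Set Plane), H z ^ δ) ^ (q / δ) := by
    rintro ⟨S, hS⟩
    obtain ⟨hSo, hSc, hSn, hSΩ, p, hSb⟩ := hFS S hS
    obtain ⟨A, D, hAS, hAc, hAn, hA0, hD, hdiam, hSf⟩ := exists_bounds_of_subset_ball hSo hSn hSb
    obtain ⟨C, hC, hW⟩ := hseg p S A hSo hSc hSb (fun j hj => hΩ.vertex_notMem j (hSΩ hj)) hAS hAc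
      hAn
    refine exists_lintegral_mul_weight_rpow_le hSo hSc hAS hAc hA0 hD hdiam hSf hWm
      (B := ENNReal.ofReal B) ENNReal.ofReal_ne_top (fun z hz => ?_) hC hW hum hgm
      (fun i => (hw i).mono hSΩ) hq hδ hqδ
      (ne_top_of_le_ne_top hgΩ (lintegral_mono_set hSΩ))
    rw [← ofReal_norm]
    exact ENNReal.ofReal_le_ofReal (hB z (subset_closure (hSΩ hz)))
  choose M hM hMu using hex
  have := hF.fintype
  refine ⟨∑ S : F, M S, ENNReal.sum_ne_top.2 fun S _ => hM S, fun H hH => ?_⟩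
  have hae : Ω ≤ᵐ[volume] ⋃ S : F, (S : Set Plane) := by
    have h1 : ∀ᵐ z, z ∉ Ω \ ⋃₀ F := measure_eq_zero_iff_ae_notMem.1 h0
    filter_upwards [h1] with z hz hzΩ
    rw [← sUnion_eq_iUnion]
    by_contra hn
    exact hz ⟨hzΩ, hn⟩
  calc _ ≤ ∫⁻ z in ⋃ S : F, (S : Set Plane), (H z * (‖cornerWeight x β z‖ₑ * ‖u z‖ₑ)) ^ q :=
        lintegral_mono' (Measure.restrict_mono_ae hae) le_rfl
    _ ≤ ∑' S : F, ∫⁻ z in (S : Set Plane), (H z * (‖cornerWeight x β z‖ₑ * ‖u z‖ₑ)) ^ q :=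
        lintegral_iUnion_le _ _
    _ = ∑ S : F, ∫⁻ z in (S : Set Plane), (H z * (‖cornerWeight x β z‖ₑ * ‖u z‖ₑ)) ^ q :=
        tsum_fintype _
    _ ≤ ∑ S : F, M S * (∫⁻ z in Ω, H z ^ δ) ^ (q / δ) := by
        refine Finset.sum_le_sum fun S _ => (hMu S H hH).trans ?_
        have : 0 ≤ q / δ := by positivity
        gcongr
        exact (hFS S S.2).2.2.2.1
    _ = _ := by rw [Finset.sum_mul]

/-- The weighted Sobolev inequality implies that the function belongs locally to the dual
of `L^δ`: on compact subsets the weight is bounded from below. -/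
theorem exists_lintegral_mul_le_of_weight {Ω K : Set Plane} (hKΩ : K ⊆ Ω) (hK : IsCompact K)
    {W : Plane → ℝ} (hW : Continuous W) (hW0 : ∀ z ∈ K, 0 < W z) {u : Plane → ℝ}
    (hum : Measurable u) {q δ : ℝ} (hq : 1 < q) (hδ : 0 < δ) {M : ℝ≥0∞} (hM : M ≠ ⊤)
    (h : ∀ H : Plane → ℝ≥0∞, Measurable H → ∫⁻ z in Ω, (H z * (‖W z‖ₑ * ‖u z‖ₑ)) ^ q ≤
        M * (∫⁻ z in Ω, H z ^ δ) ^ (q / δ)) :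
    ∃ C : ℝ≥0∞, C ≠ ⊤ ∧ ∀ f : Plane → ℝ, Measurable f →
      ∫⁻ z in K, ‖u z‖ₑ * ‖f z‖ₑ ≤ C * eLpNorm f (ENNReal.ofReal δ) := by
  have hq0 : 0 < q := by linarith
  obtain ⟨c, hc, hcW⟩ : ∃ c : ℝ, 0 < c ∧ ∀ z ∈ K, c ≤ W z := by
    rcases K.eq_empty_or_nonempty with rfl | hKn
    · exact ⟨1, one_pos, by simp⟩
    · obtain ⟨z₀, hz₀, hmin⟩ := hK.exists_isMinOn hKn hW.continuousOn
      exact ⟨W z₀, hW0 z₀ hz₀, fun z hz => hmin hz⟩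
  have hcj : q.HolderConjugate (q / (q - 1)) := Real.HolderConjugate.conjExponent hq
  have hq' := hcj.symm.pos
  set c' := (ENNReal.ofReal c)⁻¹
  have hc't : c' ≠ ⊤ := ENNReal.inv_ne_top.2 (by simpa using hc)
  refine ⟨c' * (M ^ (1 / q) * volume K ^ (1 / (q / (q - 1)))), ?_, fun f hf => ?_⟩
  · exact ENNReal.mul_ne_top hc't (ENNReal.mul_ne_top
      (ENNReal.rpow_ne_top_of_nonneg (by positivity) hM)
      (ENNReal.rpow_ne_top_of_nonneg (by positivity) hK.measure_lt_top.ne))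
  have hm : Measurable fun z => ‖f z‖ₑ * (‖W z‖ₑ * ‖u z‖ₑ) :=
    hf.enorm.mul (hW.measurable.enorm.mul hum.enorm)
  have hol := ENNReal.lintegral_mul_le_Lp_mul_Lq (volume.restrict K) hcj
    (f := fun z => ‖f z‖ₑ * (‖W z‖ₑ * ‖u z‖ₑ)) (g := fun _ => 1) hm.aemeasurable (by fun_prop)
  simp only [Pi.mul_apply, mul_one, ENNReal.one_rpow, lintegral_const, one_mul,
    Measure.restrict_apply_univ] at hol
  calc ∫⁻ z in K, ‖u z‖ₑ * ‖f z‖ₑ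
      ≤ ∫⁻ z in K, c' * (‖f z‖ₑ * (‖W z‖ₑ * ‖u z‖ₑ)) := by
        refine setLIntegral_mono' hK.measurableSet fun z hz => ?_
        have h1 : 1 ≤ c' * ‖W z‖ₑ := by
          rw [← ENNReal.inv_mul_cancel (a := ENNReal.ofReal c) (by simpa using hc)
            ENNReal.ofReal_ne_top, Real.enorm_of_nonneg (hW0 z hz).le]
          gcongr
          exact hcW z hz
        calc ‖u z‖ₑ * ‖f z‖ₑ = 1 * (‖u z‖ₑ * ‖f z‖ₑ) := (one_mul _).symm
          _ ≤ c' * ‖W z‖ₑ * (‖u z‖ₑ * ‖f z‖ₑ) := by gcongr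
          _ = _ := by ring
    _ = c' * ∫⁻ z in K, ‖f z‖ₑ * (‖W z‖ₑ * ‖u z‖ₑ) := lintegral_const_mul' _ _ hc't
    _ ≤ c' * ((M * (∫⁻ z, ‖f z‖ₑ ^ δ) ^ (q / δ)) ^ (1 / q) * volume K ^ (1 / (q / (q - 1)))) := by
        refine mul_le_mul_right (hol.trans (mul_le_mul_left ?_ _)) _
        refine ENNReal.rpow_le_rpow ?_ (by positivity)
        refine (lintegral_mono_set hKΩ).trans ((h _ hf.enorm).trans ?_)
        gcongr
        exact Measure.restrict_le_self
    _ = _ := by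
        rw [ENNReal.mul_rpow_of_nonneg _ _ (by positivity), ← ENNReal.rpow_mul,
          eLpNorm_eq_lintegral_rpow_enorm_toReal (by simpa using hδ) ENNReal.ofReal_ne_top,
          ENNReal.toReal_ofReal hδ.le, show q / δ * (1 / q) = 1 / δ by field_simp]
        ring

theorem exists_measurable_representative {U : Set Plane} {f : Plane → ℝ}
    (hf : AEStronglyMeasurable f (volume.restrict U)) :
    ∃ f' : Plane → ℝ, Measurable f' ∧ f =ᵐ[volume.restrict U] f' :=
  ⟨hf.mk f, hf.stronglyMeasurable_mk.measurable, hf.ae_eq_mk⟩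

/-! ### The product -/

theorem lemma3p6 {m : ℕ} [NeZero m] (Ω : Set Plane) (x : Fin m → Plane) (om : Fin m → ℝ)
    (hΩ : IsPolygonalDomain Ω x om)
    (a : Plane → Matrix (Fin 2) (Fin 2) ℝ) (ha : IsEllipticCoeff Ω a)
    (lam : Fin m → ℝ)
    (hlam : ∀ j, IsLeadingExponent (a (x j)) (x j) (x (j + 1) - x j) (om j) (lam j))
    (R : Fin m → ℝ) (hR : AdmissibleRadii x R)
    (q : ℝ) (hq : 1 < q)
    (δ : ℝ≥0∞) (hδ : max 2 (ENNReal.ofReal q) < δ)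
    (β : Fin m → ℝ)
    (hβ : ∀ j, 2 - 2 / q - lam j < β j ∧ β j < 2 - 2 / q ∧ 0 ≤ β j)
    (φ ψ : Plane → ℝ)
    (hφ : MemSobolev Ω δ φ)
    (hψ : MemWeightedSobolev Ω x R β (ENNReal.ofReal q) ψ) :
    MemWeightedSobolev Ω x R β (ENNReal.ofReal q) (fun z => ψ z * φ z) := by
  have hq0 : 0 < q := by linarith
  have hβ0 : ∀ j, 0 ≤ β j := fun j => (hβ j).2.2
  have hΩf : volume Ω ≠ ⊤ := hΩ.isBounded.measure_lt_top.ne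
  have : IsFiniteMeasure (volume.restrict Ω) := ⟨by simpa using hΩf.lt_top⟩
  -- as `Ω` is bounded, the exponent `δ` may be taken to be finite
  obtain ⟨d, hd2, hdq, hdδ⟩ : ∃ d : ℝ, 2 < d ∧ q < d ∧ ENNReal.ofReal d ≤ δ := by
    obtain ⟨d, hd1, hd2⟩ := ENNReal.lt_iff_exists_nnreal_btwn.1 hδ
    rw [max_lt_iff] at hd1
    refine ⟨d, by exact_mod_cast hd1.1, ?_, by simpa using hd2.le⟩
    have := hd1.2
    rw [← ENNReal.ofReal_coe_nnreal] at this
    exact (ENNReal.ofReal_lt_ofReal_iff_of_nonneg hq0.le).1 this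
  obtain ⟨gφ₀, hwφ₀, -, hgφ₀⟩ := hφ
  rw [memWeightedSobolev_iff hΩ.isOpen hΩ.isBounded hR hβ0 hq0] at hψ ⊢
  obtain ⟨gψ₀, hwψ₀, hψ₀, hgψ₀⟩ := hψ
  -- measurable representatives
  obtain ⟨v, hvm, hv⟩ := exists_measurable_representative (hwφ₀ 0).1.aestronglyMeasurable
  obtain ⟨u, hum, hu⟩ := exists_measurable_representative (hwψ₀ 0).1.aestronglyMeasurable
  choose gv hgvm hgv using fun i =>
    exists_measurable_representative (hwφ₀ i).2.1.aestronglyMeasurable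
  choose gu hgum hgu using fun i =>
    exists_measurable_representative (hwψ₀ i).2.1.aestronglyMeasurable
  have hwv : ∀ i, HasWeakPartialDeriv Ω i v (gv i) := fun i => (hwφ₀ i).congr hv (hgv i)
  have hwu : ∀ i, HasWeakPartialDeriv Ω i u (gu i) := fun i => (hwψ₀ i).congr hu (hgu i)
  have hLv : ∀ i, MemLp (gv i) (ENNReal.ofReal d) (volume.restrict Ω) := fun i =>
    ((memLp_congr_ae (hgv i)).1 (hgφ₀ i)).mono_exponent hdδ
  have hLu : MemLp (fun z => cornerWeight x β z * u z) (ENNReal.ofReal q) (volume.restrict Ω) :=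
    (memLp_congr_ae ((ae_eq_refl _).mul hu)).1 hψ₀
  have hLgu : ∀ i, MemLp (fun z => cornerWeight x β z * gu i z) (ENNReal.ofReal q)
      (volume.restrict Ω) := fun i => (memLp_congr_ae ((ae_eq_refl _).mul (hgu i))).1 (hgψ₀ i)
  have hWm := (continuous_cornerWeight x hβ0).measurable
  -- the two embeddings
  obtain ⟨M, hM, hvM⟩ := hΩ.exists_ae_enorm_le hvm hgvm hwv hd2 hLv
  obtain ⟨C, hC, hCu⟩ := hΩ.exists_lintegral_mul_cornerWeight_rpow_le hβ0 hum hgum hwu hq hd2 hdq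
    hLgu
  have hvM' : ∀ᵐ z, z ∈ Ω → ‖v z‖ ≤ M.toReal := by
    filter_upwards [hvM] with z hz hzΩ
    rw [← toReal_enorm]
    exact ENNReal.toReal_mono hM (hz hzΩ)
  have hvMΩ : ∀ᵐ z ∂(volume.restrict Ω), ‖v z‖ ≤ M.toReal :=
    (ae_restrict_iff' hΩ.isOpen.measurableSet).2 hvM'
  have mulv : ∀ {f : Plane → ℝ}, Measurable f →
      MemLp (fun z => cornerWeight x β z * f z) (ENNReal.ofReal q) (volume.restrict Ω) →
      MemLp (fun z => cornerWeight x β z * (f z * v z)) (ENNReal.ofReal q)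
        (volume.restrict Ω) := by
    intro f hfm hf
    refine hf.of_le_mul (c := M.toReal) (hWm.mul (hfm.mul hvm)).aestronglyMeasurable ?_
    filter_upwards [hvMΩ] with z hz
    rw [← mul_assoc, norm_mul, mul_comm]
    gcongr
  refine ⟨fun i z => gu i z * v z + u z * gv i z, fun i => ?_, ?_, fun i => ?_⟩
  · refine HasWeakPartialDeriv.congr (HasWeakPartialDeriv.mul hΩ.isOpen hΩf (hwu i) (hwv i) hum
      (hgum i) hvm (hgvm i) hvM' (p := ENNReal.ofReal d) ?_ ENNReal.ofReal_ne_top (hLv i)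
      fun K hKΩ hK => ?_) (hu.symm.mul hv.symm) (ae_eq_refl _)
    · rw [ENNReal.one_le_ofReal]
      linarith
    · refine exists_lintegral_mul_le_of_weight hKΩ hK (continuous_cornerWeight x hβ0)
        (fun z hz => ?_) hum hq (by linarith) hC hCu
      refine Finset.prod_pos fun j _ => Real.rpow_pos_of_pos (dist_pos.2 ?_) _
      rintro rfl
      exact hΩ.vertex_notMem j (hKΩ hz)
  · exact (memLp_congr_ae ((ae_eq_refl (cornerWeight x β)).mul (hu.symm.mul hv.symm))).1
      (mulv hum hLu)
  · have h2 : MemLp (fun z => cornerWeight x β z * (u z * gv i z)) (ENNReal.ofReal q)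
        (volume.restrict Ω) := by
      refine (memLp_ofReal_iff_lintegral hq0
        (hWm.mul (hum.mul (hgvm i))).aestronglyMeasurable).2 ?_
      have h3 := (memLp_ofReal_iff_lintegral (by linarith : 0 < d) (hLv i).1).1 (hLv i)
      refine ne_top_of_le_ne_top (ENNReal.mul_ne_top hC (ENNReal.rpow_ne_top_of_nonneg
        (by positivity) h3)) (le_trans (le_of_eq ?_) (hCu _ (hgvm i).enorm))
      refine lintegral_congr fun z => ?_
      simp only [Pi.mul_apply, enorm_mul]
      congr 1
      ring
    refine ((mulv (hgum i) (hLgu i)).add h2).congr_norm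
      (hWm.mul (((hgum i).mul hvm).add (hum.mul (hgvm i)))).aestronglyMeasurable
      (.of_forall fun z => ?_)
    simp only [Pi.add_apply, mul_add]
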